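/- **Setting and definitions.** Let $C$ be a small category. A *quotient* of an object $G$ is an object $F$ with an epimorphism $G\to F$; quotients of $G$ are taken up to isomorphism under $G$, and they are partially ordered by $F\le H$ if there is a morphism $H\to F$ compatible with the morphisms from $G$. An object is *minimal* if its only quotient is itself. A set of isomorphism classes of objects of $C$ is a *formation* if it contains every minimal object, is closed under taking quotients, and is join-closed: if $H, F$ in the set are quotients of some object $G$ and the join $H\vee F$ exists in the partially ordered set of quotients of $G$, then $H\vee F$ is in the set. A *level* is the smallest formation containing some given finite set of isomorphism classes. An epimorphism is *simple* if it is not an isomorphism and whenever it is written as a composition of two epimorphisms, one of them is an isomorphism. $C$ is a *diamond category* if (1) for every object $G$ the quotients of $G$ form a finite modular lattice; (2) every object has finite automorphism group; (3) for every level $L$ and every $G\in L$ there are only finitely many elements of $L$ with a simple epimorphism to $G$; (4) there are at most countably many isomorphism classes of minimal objects. Let $C$ be a diamond category. For an epimorphism $\pi\colon G\to F$ let $\mu(\pi)=\mu(F,G)$, where $\mu$ is the Möbius function of the partially ordered set of quotients of $G$; let $[F,G]$ be the interval of quotients of $G$ that are $\ge F$, and let $Z(\pi)$ be the number of $H\in[F,G]$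 such that $H\vee(K_1\wedge K_2)=(H\vee K_1)\wedge(H\vee K_2)$ for all $K_1,K_2\in[F,G]$. Put $\hat\mu(F,G)=\sum_{\pi\in \mathrm{Epi}(G,F)/\mathrm{Aut}(F)}\mu(\pi)$. All sums below are over isomorphism classes. Real numbers $(M_G)_{G\in L}$ are *well-behaved* at $L$ if for all $F\in L$ $$\sum_{G\in L}\ \sum_{\pi\in\mathrm{Epi}(G,F)}\frac{|\mu(\pi)|}{|\mathrm{Aut}(G)|}\,Z(\pi)^3\,|M_G|<\infty .$$ A level $L$ carries the discrete $\sigma$-algebra, and for $G\in L$ the *$G$-moment* of a (nonnegative) measure $\nu$ on $L$ is $\int_{F\in L}|\mathrm{Epi}(F,G)|\,d\nu\in[0,\infty]$. **Theorem (Distributions on a level from moments).** Let $C$ be a diamond category, let $L$ be a level of $C$, and for each $G\in L$ let $M_G$ be a real number such that $(M_G)_{G\in L}$ is well-behaved at $L$. For $F\in L$ let $$v_{L,F}=\sum_{G\in L}\frac{\hat\mu(F,G)}{|\mathrm{Aut}(G)|}M_G ,$$ a series which converges absolutely. 1. (Existence) A measure $\nu$ on $L$ with $G$-moment $M_G$ for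 all $G\in L$ exists if and only if $v_{L,F}\ge 0$ for all $F\in L$. 2. (Uniqueness) If such a measure $\nu$ exists, then it is unique, and $\nu(\{F\})=v_{L,F}$ for all $F\in L$. 3. (Robustness) If $\nu^t$, $t\in\mathbb N$, are measures on $L$ such that $\lim_{t\to\infty}\int_{F\in L}|\mathrm{Epi}(F,G)|\,d\nu^t=M_G$ for each $G\in L$, then $\lim_{t\to\infty}\nu^t(\{F\})=v_{L,F}$ for each $F\in L$. -/

import Mathlib

open CategoryTheory Opposite MeasureTheory Filter Topology

universe u v

namespace DiamondMoments

section General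

variable {C : Type u} [Category.{v} C]

/-- Isomorphism classes of quotients of `G`, i.e. of epimorphisms out of `G`. A quotient of `G` in
`C` is a subobject of `G` in the opposite category, with the order `F ≤ H` if and only if there is
a morphism `H ⟶ F` compatible with the morphisms from `G`. -/
abbrev Quotients (G : C) : Type (max u v) := Subobject (op G)

/-- The set `Epi(G, F)` of epimorphisms from `G` to `F`. -/
abbrev EpiHom (G F : C) : Type v := {π : G ⟶ F // Epi π}

/-- The quotient of `G` given by an epimorphism `π : G ⟶ F`. -/
noncomputable def toQuotient {G F : C} (π : EpiHom G F) : Quotients G :=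
  haveI := π.2
  Subobject.mk π.1.op

theorem toQuotient_le_iff {G F H : C} (π : EpiHom G F) (ρ : EpiHom G H) :
    toQuotient π ≤ toQuotient ρ ↔ ∃ h : H ⟶ F, ρ.1 ≫ h = π.1 := by
  have := π.2
  have := ρ.2
  constructor
  · intro h
    refine ⟨(Subobject.ofMkLEMk _ _ h).unop, Quiver.Hom.op_inj ?_⟩
    simpa using Subobject.ofMkLEMk_comp h
  · rintro ⟨h, hh⟩
    refine Subobject.mk_le_mk_of_comm h.op ?_
    rw [← op_comp, hh]

/-- `G` is minimal if its only quotient is `G` itself. -/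
def IsMinimalObject (G : C) : Prop := ∀ x : Quotients G, x = ⊤

/-- Simple epimorphisms: not an isomorphism, and whenever written as a composition of two
epimorphisms, one of them is an isomorphism. -/
def IsSimpleEpi {G F : C} (π : G ⟶ F) : Prop :=
  Epi π ∧ ¬ IsIso π ∧
    ∀ (H : C) (f : G ⟶ H) (g : H ⟶ F), Epi f → Epi g → f ≫ g = π → IsIso f ∨ IsIso g

variable (C) in
/-- The set of isomorphism classes of objects of `C`. -/
def IsoClasses : Type u := Quotient (isIsomorphicSetoid C)

/-- The isomorphism class of an object. -/
def IsoClasses.mk (G : C) : IsoClasses C := Quotient.mk (isIsomorphicSetoid C) G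

/-- An object in a given isomorphism class. It is only used inside expressions that are invariant
under isomorphism. -/
noncomputable def IsoClasses.rep (X : IsoClasses C) : C := Quotient.out X

/-- The isomorphism class (in `C`) of the object underlying a quotient of `G`. -/
noncomputable def quotientClass {G : C} (x : Quotients G) : IsoClasses C :=
  IsoClasses.mk (x : Cᵒᵖ).unop

/-- Sets of isomorphism classes closed under taking quotients. -/
def IsDownwardClosed (S : Set (IsoClasses C)) : Prop :=
  ∀ (G : C) (x : Quotients G), IsoClasses.mk G ∈ S → quotientClass x ∈ S

/-- Sets of isomorphism classes closed under those joins of quotients of an object that exist. -/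
def IsJoinClosed (S : Set (IsoClasses C)) : Prop :=
  ∀ (G : C) (x y z : Quotients G), IsLUB {x, y} z →
    quotientClass x ∈ S → quotientClass y ∈ S → quotientClass z ∈ S

/-- A formation: a downward-closed join-closed set of isomorphism classes that contains every
minimal object. -/
def IsFormation (S : Set (IsoClasses C)) : Prop :=
  IsDownwardClosed S ∧ IsJoinClosed S ∧ ∀ G : C, IsMinimalObject G → IsoClasses.mk G ∈ S

/-- `B` generates `S` if `S` is the smallest formation containing `B`. -/
def Generates (B S : Set (IsoClasses C)) : Prop :=
  IsLeast {T : Set (IsoClasses C) | IsFormation T ∧ B ⊆ T} S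

/-- A level: a set of isomorphism classes generated by a finite set. -/
def IsLevel (L : Set (IsoClasses C)) : Prop :=
  ∃ B : Set (IsoClasses C), B.Finite ∧ Generates B L

end General

/-- The quotients of every object form a finite lattice. -/
class FiniteQuotientLattices (C : Type u) [Category.{v} C] : Prop where
  finite_quotients : ∀ G : C, Finite (Quotients G)
  exists_join : ∀ (G : C) (x y : Quotients G), ∃ z, IsLUB {x, y} z
  exists_meet : ∀ (G : C) (x y : Quotients G), ∃ z, IsGLB {x, y} z

section Lattice

variable {C : Type u} [Category.{v} C] [FiniteQuotientLattices C]

instance (G : C) : Finite (Quotients G) := FiniteQuotientLattices.finite_quotients G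

/-- The lattice structure of the partially ordered set of quotients of `G`. -/
noncomputable instance (G : C) : Lattice (Quotients G) :=
  { (inferInstance : PartialOrder (Quotients G)) with
    sup := fun x y => (FiniteQuotientLattices.exists_join G x y).choose
    inf := fun x y => (FiniteQuotientLattices.exists_meet G x y).choose
    le_sup_left := fun x y =>
      (FiniteQuotientLattices.exists_join G x y).choose_spec.1 (Set.mem_insert _ _)
    le_sup_right := fun x y =>
      (FiniteQuotientLattices.exists_join G x y).choose_spec.1
        (Set.mem_insert_of_mem _ (Set.mem_singleton _))
    sup_le := fun x y z hx hy =>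
      (FiniteQuotientLattices.exists_join G x y).choose_spec.2 (by
        rintro w (rfl | rfl)
        · exact hx
        · exact hy)
    inf_le_left := fun x y =>
      (FiniteQuotientLattices.exists_meet G x y).choose_spec.1 (Set.mem_insert _ _)
    inf_le_right := fun x y =>
      (FiniteQuotientLattices.exists_meet G x y).choose_spec.1
        (Set.mem_insert_of_mem _ (Set.mem_singleton _))
    le_inf := fun z x y hx hy =>
      (FiniteQuotientLattices.exists_meet G x y).choose_spec.2 (by
        rintro w (rfl | rfl)
        · exact hx
        · exact hy) }

noncomputable instance (G : C) : LocallyFiniteOrder (Quotients G) :=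
  LocallyFiniteOrder.ofFiniteIcc fun _ _ => Set.toFinite _

open Classical in
/-- `μ(π) = μ(F, G)` for an epimorphism `π : G ⟶ F`: the Möbius function of the partially ordered
set of quotients of `G`, from the quotient given by `π` to `G` itself. -/
noncomputable def mobius {G F : C} (π : EpiHom G F) : ℤ :=
  IncidenceAlgebra.mu ℤ (toQuotient π) ⊤

/-- The orbit relation of `Aut(F)` on `Epi(G, F)`. -/
def autSetoid (G F : C) : Setoid (EpiHom G F) where
  r π ρ := ∃ σ : F ≅ F, π.1 ≫ σ.hom = ρ.1
  iseqv :=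
    { refl := fun _ => ⟨Iso.refl F, Category.comp_id _⟩
      symm := by
        rintro π ρ ⟨σ, h⟩
        exact ⟨σ.symm, by rw [← h]; simp⟩
      trans := by
        rintro π ρ τ ⟨σ, h⟩ ⟨σ', h'⟩
        exact ⟨σ.trans σ', by rw [← h', ← h]; simp⟩ }

theorem mobius_eq_of_rel {G F : C} (π ρ : EpiHom G F) (h : autSetoid G F π ρ) :
    mobius π = mobius ρ := by
  have key : toQuotient π = toQuotient ρ := by
    obtain ⟨σ, hσ⟩ := h
    refine le_antisymm ((toQuotient_le_iff _ _).2 ⟨σ.inv, ?_⟩)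
      ((toQuotient_le_iff _ _).2 ⟨σ.hom, hσ⟩)
    rw [← hσ]; simp
  unfold mobius
  rw [key]

/-- `μ̂(F, G)`, the (finite) sum of `μ(π)` over `Epi(G, F) / Aut(F)`. -/
noncomputable def mobiusHat (F G : C) : ℤ :=
  ∑ᶠ q : Quotient (autSetoid G F), Quotient.lift mobius mobius_eq_of_rel q

/-- `Z(π)`: the number of `H` in the interval `[F, G]` that satisfy the distributive law
`H ⊔ (K₁ ⊓ K₂) = (H ⊔ K₁) ⊓ (H ⊔ K₂)` for all `K₁`, `K₂` in `[F, G]`. -/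
noncomputable def distributiveCount {G F : C} (π : EpiHom G F) : ℕ :=
  Nat.card {H : Quotients G // toQuotient π ≤ H ∧
    ∀ K₁ K₂ : Quotients G, toQuotient π ≤ K₁ → toQuotient π ≤ K₂ →
      H ⊔ (K₁ ⊓ K₂) = (H ⊔ K₁) ⊓ (H ⊔ K₂)}

end Lattice

/-- Diamond categories. -/
class DiamondCategory (C : Type u) [Category.{v} C] : Prop extends FiniteQuotientLattices C where
  modular : ∀ G : C, IsModularLattice (Quotients G)
  finite_aut : ∀ G : C, Finite (Aut G)
  finite_simple : ∀ L : Set (IsoClasses C), IsLevel L → ∀ G : C, IsoClasses.mk G ∈ L →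
    {X : IsoClasses C | X ∈ L ∧
      ∃ (H : C) (π : H ⟶ G), IsoClasses.mk H = X ∧ IsSimpleEpi π}.Finite
  countable_minimal :
    {X : IsoClasses C | ∃ G : C, IsMinimalObject G ∧ IsoClasses.mk G = X}.Countable

section Moments

variable {C : Type u} [Category.{v} C]

/-- The discrete `σ`-algebra; subsets of `IsoClasses C` then carry the discrete `σ`-algebra too. -/
instance : MeasurableSpace (IsoClasses C) := ⊤

instance (S : Set (IsoClasses C)) : DiscreteMeasurableSpace S where
  forall_measurableSet s := ⟨Subtype.val '' s, trivial, Set.preimage_image_eq s Subtype.val_injective⟩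

/-- The `G`-moment `∫ |Epi(F, G)| dν(F)` of a measure on a set of isomorphism classes. -/
noncomputable def moment {S : Set (IsoClasses C)} (ν : Measure S) (G : S) : ENNReal :=
  ∫⁻ F : S, (Nat.card (EpiHom F.1.rep G.1.rep) : ENNReal) ∂ν

/-- `ν` has `G`-moment the real number `M G` for all `G` (as an equality of extended reals, so that
the moments are finite and the `M G` nonnegative). -/
def HasMoments {S : Set (IsoClasses C)} (ν : Measure S) (M : S → ℝ) : Prop :=
  ∀ G : S, (moment ν G : EReal) = (M G : EReal)

variable [FiniteQuotientLattices C]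

/-- `(M_G)` is well-behaved at `S`: for all `F` in `S`,
`∑_{G ∈ S} ∑_{π ∈ Epi(G, F)} |μ(π)| / |Aut(G)| * Z(π) ^ 3 * |M_G| < ∞`. -/
def WellBehaved (S : Set (IsoClasses C)) (M : S → ℝ) : Prop :=
  ∀ F : S, Summable fun p : (Σ G : S, EpiHom G.1.rep F.1.rep) =>
    |(mobius p.2 : ℝ)| / (Nat.card (Aut p.1.1.rep) : ℝ) *
      (distributiveCount p.2 : ℝ) ^ 3 * |M p.1|

/-- The `G`-term of the series defining `v_{S, F}`. -/
noncomputable def vTerm (S : Set (IsoClasses C)) (M : S → ℝ) (F G : S) : ℝ :=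
  (mobiusHat F.1.rep G.1.rep : ℝ) / (Nat.card (Aut G.1.rep) : ℝ) * M G

/-- `v_{S, F} = ∑_{G ∈ S} μ̂(F, G) / |Aut(G)| * M_G`. -/
noncomputable def vSum (S : Set (IsoClasses C)) (M : S → ℝ) (F : S) : ℝ :=
  ∑' G : S, vTerm S M F G

end Moments

end DiamondMoments

set_option linter.unusedSectionVars false

/-! In a modular lattice, if `c` is a coatom of `[x, d]`, then `μ(x, d) = -q μ(x, c)`, where `q`
counts the atoms of `[x, d]` not below `c` (`mob_covBy`, from Weisner's theorem). So the sign of `μ`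
alternates with length, and the sums of `μ(x, ·)` over elements of length at most `n` satisfy
Bonferroni inequalities (`neg_one_pow_mul_truncSum_nonneg`).

Robustness: for fixed `F`, sum `μ(π) / |Aut(G)|` times the `G`-moment over the epimorphisms `π : G ⟶
F` of length at most `n`. The sum is finite by axiom (3). Counting factorizations of epimorphisms `X
⟶ F` through `G` shows that it bounds `|Aut(F)| ν({F})` from above for even `n` and from below for
odd `n` (`neg_one_pow_mul_sum_moment_nonneg`). Letting first `t` and then `n` tend to infinity
squeezes `ν^t({F})` to `v_{L,F}` (`tendsto_of_tendsto_moment`). Uniqueness is the case of a constant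
sequence, `L` being countable, and it gives the necessity of `v ≥ 0`.

Existence: give `F` the mass `v_{L,F}`. The identity `M_B = ∑ v_{L,F} |Epi(F, B)|` needs an exchange
of sums, done in steps governed by Loewy length, the number of semisimple intervals needed to climb
a lattice, which is bounded on a level (`IsLevel.exists_loewyBounded`). The quantities `layer M k σ`
interpolate between `M_B` at `k = 0` and `|Aut(T)| v_{L,T}` at large `k`. Each is a combination of
the next ones with nonnegative coefficients (`hasSum_layer`): algebraically this is Weisner's
theorem (`sum_mob_loewyLE`), analytically the bound `∑ |μ(K, y)| ≤ |μ(x, y)| Z ^ 3`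
(`sum_abs_mob_le'`), which is what well-behavedness is made for. Downward induction on `k` makes all
layers nonnegative, and iterating the recursion in `[0, ∞]` gives the identity
(`ofReal_moment_eq_tsum`).

The cubic bound is projective geometry: atoms are adjoined one at a time, and each perspectivity
class of atoms costs at most a factor `8 = 2 ^ 3`, while sets of classes give distinct elements
counted by `Z`. -/

namespace DiamondMoments

/-! ### Möbius functions of modular lattices. -/

section Mobius

open Classical in
/-- The Möbius function of a locally finite partial order. -/
noncomputable def mob {α : Type*} [PartialOrder α] [LocallyFiniteOrder α] (x y : α) : ℤ :=
  IncidenceAlgebra.mu ℤ x y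

variable {α β : Type*}

section Order

variable [PartialOrder α] [LocallyFiniteOrder α] [PartialOrder β] [LocallyFiniteOrder β]

theorem mob_self (x : α) : mob x x = 1 := by
  classical
  exact IncidenceAlgebra.mu_self x

theorem le_of_mob_ne_zero {x y : α} (h : mob x y ≠ 0) : x ≤ y := by
  classical
  exact IncidenceAlgebra.le_of_ne_zero h

open Classical in
theorem sum_Icc_mob_right (x y : α) :
    ∑ z ∈ Finset.Icc x y, mob x z = if x = y then 1 else 0 := by
  simpa [mob] using IncidenceAlgebra.sum_Icc_mu_right (𝕜 := ℤ) x y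

open Classical in
theorem sum_Icc_mob_left (x y : α) :
    ∑ z ∈ Finset.Icc x y, mob z y = if x = y then 1 else 0 := by
  simpa [mob] using IncidenceAlgebra.sum_Icc_mu_left (𝕜 := ℤ) x y

theorem mob_toDual (x y : α) : mob (OrderDual.toDual x) (OrderDual.toDual y) = mob y x := by
  classical
  have := IncidenceAlgebra.mu_toDual (𝕜 := ℤ) (α := α) x y
  unfold mob
  convert this <;> rfl

/-- The Möbius function depends only on the interval, by its recursion. It suffices that `f` is an
order isomorphism between the intervals, as in the diamond isomorphism and for quotients of
quotients. -/
theorem mob_eq_of_interval [Finite α] (f : α → β) {a b : α} (hab : a ≤ b)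
    (hf : ∀ z w, a ≤ z → z ≤ b → a ≤ w → w ≤ b → (f z ≤ f w ↔ z ≤ w))
    (hs : ∀ y, f a ≤ y → y ≤ f b → ∃ z, a ≤ z ∧ z ≤ b ∧ f z = y) :
    mob (f a) (f b) = mob a b := by
  classical
  have inj : ∀ z w, a ≤ z → z ≤ b → a ≤ w → w ≤ b → f z = f w → z = w := fun z w h1 h2 h3 h4 h =>
    le_antisymm ((hf z w h1 h2 h3 h4).1 h.le) ((hf w z h3 h4 h1 h2).1 h.ge)
  suffices H : ∀ z, a ≤ z → z ≤ b → mob (f a) (f z) = mob a z from H b hab le_rfl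
  intro z
  induction z using WellFoundedLT.induction with
  | ind z ih =>
    intro haz hzb
    by_cases h : a = z
    · subst h; rw [mob_self, mob_self]
    · have h' : f a ≠ f z := fun e => h (inj a z le_rfl hab haz hzb e)
      unfold mob
      rw [IncidenceAlgebra.mu_eq_neg_sum_Ico_of_ne h, IncidenceAlgebra.mu_eq_neg_sum_Ico_of_ne h']
      congr 1
      symm
      refine Finset.sum_nbij f ?_ ?_ ?_ ?_
      · intro w hw
        rw [Finset.mem_Ico] at hw ⊢
        have hwb : w ≤ b := hw.2.le.trans hzb
        refine ⟨(hf a w le_rfl hab hw.1 hwb).2 hw.1, lt_of_le_of_ne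
          ((hf w z hw.1 hwb haz hzb).2 hw.2.le) fun e => hw.2.ne (inj w z hw.1 hwb haz hzb e)⟩
      · intro w hw w' hw' e
        rw [Finset.mem_coe, Finset.mem_Ico] at hw hw'
        exact inj _ _ hw.1 (hw.2.le.trans hzb) hw'.1 (hw'.2.le.trans hzb) e
      · intro y hy
        rw [Finset.mem_coe, Finset.mem_Ico] at hy
        obtain ⟨w, h1, h2, rfl⟩ := hs y hy.1 (hy.2.le.trans ((hf z b haz hzb hab le_rfl).2 hzb))
        refine ⟨w, ?_, rfl⟩
        rw [Finset.mem_coe, Finset.mem_Ico]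
        refine ⟨h1, lt_of_le_of_ne ((hf w z h1 h2 haz hzb).1 hy.2.le) ?_⟩
        rintro rfl
        exact hy.2.ne rfl
      · intro w hw
        rw [Finset.mem_Ico] at hw
        have := ih w hw.2 hw.1 (hw.2.le.trans hzb)
        unfold mob at this
        exact this.symm

end Order

section Covers

variable [Lattice α]

theorem inf_eq_of_newAtom {x c a : α} (hxc : x ≤ c) (h : x ⋖ a) (h' : ¬ a ≤ c) : a ⊓ c = x := by
  rcases h.eq_or_eq (le_inf h.le hxc) inf_le_left with h1 | h1
  · exact h1
  · exact absurd (h1 ▸ inf_le_right) h'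

theorem sup_eq_of_covBy {c d a : α} (h : c ⋖ d) (had : a ≤ d) (h' : ¬ a ≤ c) : a ⊔ c = d := by
  rcases h.eq_or_eq le_sup_right (sup_le had h.le) with h1 | h1
  · exact absurd (h1 ▸ le_sup_left) h'
  · exact h1

variable [IsModularLattice α]

theorem covBy_sup_of_newAtom {x c a : α} (hxc : x ≤ c) (h : x ⋖ a) (h' : ¬ a ≤ c) : c ⋖ a ⊔ c := by
  refine covBy_sup_of_inf_covBy_left ?_
  rwa [inf_eq_of_newAtom hxc h h']

theorem inf_covBy_of_covBy {c d z : α} (h : c ⋖ d) (hzd : z ≤ d) (h' : ¬ z ≤ c) : z ⊓ c ⋖ z := by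
  have h1 := sup_eq_of_covBy h hzd h'
  have : c ⋖ z ⊔ c := by rwa [h1]
  exact inf_covBy_of_covBy_sup_right this

end Covers

section Modular

variable [Lattice α] [LocallyFiniteOrder α]

open Classical in
/-- Weisner's theorem. -/
theorem weisner {x c d : α} (hcd : c < d) :
    ∑ z ∈ Finset.Icc x d with z ⊓ c = x, mob z d = 0 := by
  -- The condition `z ⊓ c = x` is detected by summing `mob x w` over `w ≤ z ⊓ c`. After exchanging
  -- sums, the inner sum over `[w, d]` vanishes because `w ≤ c < d`.
  have h1 : ∀ z ∈ Finset.Icc x d, (if z ⊓ c = x then mob z d else 0)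
      = ∑ w ∈ Finset.Icc x c, if w ≤ z then mob x w * mob z d else 0 := by
    intro z hz
    rw [Finset.mem_Icc] at hz
    have := sum_Icc_mob_right x (z ⊓ c)
    rw [← Finset.sum_filter, ← Finset.sum_mul]
    have h2 : (Finset.Icc x c).filter (fun w => w ≤ z) = Finset.Icc x (z ⊓ c) := by
      ext w; simp only [Finset.mem_filter, Finset.mem_Icc, le_inf_iff]; tauto
    rw [h2, this]
    by_cases h : z ⊓ c = x
    · simp [h]
    · simp [h, Ne.symm h]
  rw [Finset.sum_filter, Finset.sum_congr rfl h1, Finset.sum_comm]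
  refine Finset.sum_eq_zero fun w hw => ?_
  rw [Finset.mem_Icc] at hw
  rw [← Finset.sum_filter, ← Finset.mul_sum]
  have h2 : (Finset.Icc x d).filter (fun z => w ≤ z) = Finset.Icc w d := by
    ext z; simp only [Finset.mem_filter, Finset.mem_Icc]
    exact ⟨fun h => ⟨h.2, h.1.2⟩, fun h => ⟨⟨hw.1.trans h.1, h.2⟩, h.1⟩⟩
  rw [h2, sum_Icc_mob_left, if_neg (hw.2.trans_lt hcd).ne, mul_zero]

open Classical in
/-- The atoms of the interval `[x, d]` that are not below `c`. -/
noncomputable def newAtoms (x c d : α) : Finset α :=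
  (Finset.Icc x d).filter fun a => x ⋖ a ∧ ¬ a ≤ c

theorem mem_newAtoms {x c d a : α} : a ∈ newAtoms x c d ↔ x ⋖ a ∧ a ≤ d ∧ ¬ a ≤ c := by
  simp only [newAtoms, Finset.mem_filter, Finset.mem_Icc]
  exact ⟨fun h => ⟨h.2.1, h.1.2, h.2.2⟩, fun h => ⟨⟨h.1.le, h.2.1⟩, h.1, h.2.2⟩⟩

variable [IsModularLattice α]

variable [Finite α]

/-- Diamond isomorphism: `z ↦ z ⊔ b` from `[a ⊓ b, a]` to `[b, a ⊔ b]` has inverse `y ↦ a ⊓ y` by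
modularity. -/
theorem mob_sup_inf (a b : α) : mob b (a ⊔ b) = mob (a ⊓ b) a := by
  have := mob_eq_of_interval (fun z => z ⊔ b) (a := a ⊓ b) (b := a) inf_le_left ?_ ?_
  · simpa using this
  · intro z w hz hz' hw hw'
    refine ⟨fun h => ?_, fun h => sup_le_sup_right h b⟩
    have h1 : (z ⊔ b) ⊓ a = z := by
      rw [sup_inf_assoc_of_le b hz', inf_comm b a, sup_eq_left.2 hz]
    have h2 : (w ⊔ b) ⊓ a = w := by
      rw [sup_inf_assoc_of_le b hw', inf_comm b a, sup_eq_left.2 hw]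
    rw [← h1, ← h2]
    exact inf_le_inf_right a h
  · intro y hy hy'
    have hby : b ≤ y := le_trans le_sup_right hy
    refine ⟨a ⊓ y, le_inf inf_le_left (inf_le_right.trans hby), inf_le_left, ?_⟩
    rw [inf_comm, inf_sup_assoc_of_le a hby]
    exact inf_eq_left.2 hy'

/-- In Weisner's theorem for the coatom `c`, only `x` and the new atoms meet `c` in `x`. A new atom
`a` is a complement of `c`, so `[a, d]` is isomorphic to `[x, c]`. -/
theorem mob_covBy {x c d : α} (hxc : x ≤ c) (hcd : c ⋖ d) :
    mob x d = - ((newAtoms x c d).card * mob x c) := by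
  classical
  have hw := weisner (x := x) hcd.lt
  have hset : (Finset.Icc x d).filter (fun z => z ⊓ c = x) = insert x (newAtoms x c d) := by
    ext z
    simp only [Finset.mem_filter, Finset.mem_insert, mem_newAtoms, Finset.mem_Icc]
    constructor
    · rintro ⟨⟨h1, h2⟩, h3⟩
      by_cases hz : z ≤ c
      · left; rwa [inf_eq_left.2 hz] at h3
      · right
        exact ⟨h3 ▸ inf_covBy_of_covBy hcd h2 hz, h2, hz⟩
    · rintro (rfl | ⟨h1, h2, h3⟩)
      · exact ⟨⟨le_rfl, hxc.trans hcd.le⟩, inf_eq_left.2 hxc⟩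
      · exact ⟨⟨h1.le, h2⟩, inf_eq_of_newAtom hxc h1 h3⟩
  rw [hset, Finset.sum_insert (by simp [mem_newAtoms])] at hw
  have : ∑ z ∈ newAtoms x c d, mob z d = ∑ z ∈ newAtoms x c d, mob x c := by
    refine Finset.sum_congr rfl fun a ha => ?_
    rw [mem_newAtoms] at ha
    have h1 := mob_sup_inf c a
    rw [sup_comm, sup_eq_of_covBy hcd ha.2.1 ha.2.2, inf_comm,
      inf_eq_of_newAtom hxc ha.1 ha.2.2] at h1
    exact h1
  rw [this, Finset.sum_const, nsmul_eq_mul] at hw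
  linarith

/-- Summation over `[x, d]` against the Möbius function in terms of summation over `[x, c]`,
where `d` covers `c`. -/
theorem sum_mob_covBy (f : α → ℤ) {x c d : α} (hxc : x ≤ c) (hcd : c ⋖ d) :
    ∑ K ∈ Finset.Icc x d, f K * mob x K = ∑ K ∈ Finset.Icc x c, f K * mob x K
      - ∑ K ∈ Finset.Icc x c, ∑ a ∈ newAtoms x c d, f (a ⊔ K) * mob x K := by
  classical
  rw [← Finset.sum_filter_add_sum_filter_not (Finset.Icc x d) (fun K => K ≤ c), sub_eq_add_neg]
  congr 1
  · refine Finset.sum_congr ?_ fun _ _ => rfl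
    ext K; simp only [Finset.mem_filter, Finset.mem_Icc]
    exact ⟨fun h => ⟨h.1.1, h.2⟩, fun h => ⟨⟨h.1, h.2.trans hcd.le⟩, h.2⟩⟩
  -- For `K` not below `c`, `mob_covBy` along `K ⊓ c ⋖ K` turns the term into a sum over new atoms
  -- `a` of `K`. The pairs `(K, a)` then correspond to pairs `(K ⊓ c, a)`, with inverse `(y, a) ↦ (a
  -- ⊔ y, a)`.
  · have h1 : ∀ K ∈ (Finset.Icc x d).filter (fun K => ¬ K ≤ c), f K * mob x K
        = ∑ a ∈ newAtoms x (K ⊓ c) K, - (f K * mob x (K ⊓ c)) := by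
      intro K hK
      simp only [Finset.mem_filter, Finset.mem_Icc] at hK
      rw [mob_covBy (le_inf hK.1.1 hxc) (inf_covBy_of_covBy hcd hK.1.2 hK.2)]
      simp only [Finset.sum_const, nsmul_eq_mul]
      ring
    rw [Finset.sum_congr rfl h1, ← Finset.sum_neg_distrib]
    simp_rw [← Finset.sum_neg_distrib]
    rw [Finset.sum_sigma', Finset.sum_sigma']
    refine Finset.sum_nbij' (fun p => ⟨p.1 ⊓ c, p.2⟩) (fun p => ⟨p.2 ⊔ p.1, p.2⟩) ?_ ?_ ?_ ?_ ?_
    · rintro ⟨K, a⟩ h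
      simp only [Finset.mem_sigma, Finset.mem_filter, Finset.mem_Icc, mem_newAtoms,
        le_inf_iff, not_and] at h ⊢
      exact ⟨⟨⟨h.1.1.1, hxc⟩, inf_le_right⟩, h.2.1, h.2.2.1.trans h.1.1.2, h.2.2.2 h.2.2.1⟩
    · rintro ⟨y, a⟩ h
      simp only [Finset.mem_sigma, Finset.mem_filter, Finset.mem_Icc, mem_newAtoms,
        le_inf_iff, not_and] at h ⊢
      exact ⟨⟨⟨h.1.1.trans le_sup_right, sup_le h.2.2.1 (h.1.2.trans hcd.le)⟩,
        fun h' => h.2.2.2 (le_sup_left.trans h')⟩, h.2.1, le_sup_left, fun _ => h.2.2.2⟩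
    · rintro ⟨K, a⟩ h
      simp only [Finset.mem_sigma, Finset.mem_filter, Finset.mem_Icc, mem_newAtoms,
        le_inf_iff, not_and] at h
      have := sup_eq_of_covBy (inf_covBy_of_covBy hcd h.1.1.2 h.1.2) h.2.2.1
        (fun h' => h.2.2.2 h.2.2.1 (h'.trans inf_le_right))
      simp only [this]
    · rintro ⟨y, a⟩ h
      simp only [Finset.mem_sigma, Finset.mem_Icc, mem_newAtoms] at h
      have : (a ⊔ y) ⊓ c = y := by
        rw [sup_comm, sup_inf_assoc_of_le a h.1.2, inf_eq_of_newAtom hxc h.2.1 h.2.2.2,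
          sup_eq_left.2 h.1.1]
      simp only [this]
    · rintro ⟨K, a⟩ h
      simp only [Finset.mem_sigma, Finset.mem_filter, Finset.mem_Icc, mem_newAtoms,
        le_inf_iff, not_and] at h
      have := sup_eq_of_covBy (inf_covBy_of_covBy hcd h.1.1.2 h.1.2) h.2.2.1
        (fun h' => h.2.2.2 h.2.2.1 (h'.trans inf_le_right))
      simp only [this]

end Modular

end Mobius

/-! ### Length in modular lattices, sign alternation and Bonferroni inequalities. -/

section Rank

variable {α β : Type*}

/-- There is a chain of `n` covering relations from `x` to `y`. -/
def CoverChain [PartialOrder α] : ℕ → α → α → Prop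
  | 0, x, y => x = y
  | n + 1, x, y => ∃ z, CoverChain n x z ∧ z ⋖ y

theorem CoverChain.le [PartialOrder α] : ∀ {n : ℕ} {x y : α}, CoverChain n x y → x ≤ y
  | 0, _, _, h => le_of_eq h
  | _ + 1, _, _, ⟨_, h1, h2⟩ => h1.le.trans h2.le

theorem exists_coverChain [PartialOrder α] [Finite α] {x : α} (y : α) (h : x ≤ y) :
    ∃ n, CoverChain n x y := by
  induction y using WellFoundedLT.induction with
  | ind y ih =>
    rcases h.eq_or_lt with rfl | h
    · exact ⟨0, rfl⟩
    · obtain ⟨z, h1, h2⟩ := exists_le_covBy_of_lt h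
      obtain ⟨n, hn⟩ := ih z h2.lt h1
      exact ⟨n + 1, z, hn, h2⟩

/-- Jordan–Hölder: if the chains end in different coatoms `z` and `z'`, both cover `z ⊓ z'`, and a
chain up to `z ⊓ z'` compares the two. -/
theorem CoverChain.unique [Lattice α] [IsModularLattice α] [Finite α] {x : α} :
    ∀ {n m : ℕ} {y : α}, CoverChain n x y → CoverChain m x y → n = m
  | 0, 0, _, _, _ => rfl
  | 0, _ + 1, _, rfl, ⟨_, h1, h2⟩ => absurd h1.le h2.lt.not_ge
  | _ + 1, 0, _, ⟨_, h1, h2⟩, rfl => absurd h1.le h2.lt.not_ge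
  | n + 1, m + 1, y, ⟨z, h1, h2⟩, ⟨z', h1', h2'⟩ => by
    by_cases hz : z = z'
    · subst hz
      rw [CoverChain.unique h1 h1']
    · have hs : z ⊔ z' = y := (CovBy.wcovBy h2).sup_eq (CovBy.wcovBy h2') hz
      have hc : z ⊓ z' ⋖ z := by
        refine inf_covBy_of_covBy_sup_right ?_
        rwa [hs]
      have hc' : z ⊓ z' ⋖ z' := by
        refine inf_covBy_of_covBy_sup_left ?_
        rwa [hs]
      obtain ⟨k, hk⟩ := exists_coverChain (z ⊓ z') (le_inf h1.le h1'.le)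
      have e1 : n = k + 1 := CoverChain.unique h1 ⟨_, hk, hc⟩
      subst e1
      rw [CoverChain.unique (n := k + 1) ⟨_, hk, hc'⟩ h1']

open Classical in
/-- The length of a chain of covering relations from `x` to `y`. -/
noncomputable def rk [PartialOrder α] (x y : α) : ℕ :=
  if h : ∃ n, CoverChain n x y then h.choose else 0

theorem coverChain_rk [PartialOrder α] [Finite α] {x y : α} (h : x ≤ y) :
    CoverChain (rk x y) x y := by
  have := exists_coverChain y h
  rw [rk, dif_pos this]
  exact this.choose_spec

variable [Lattice α] [IsModularLattice α] [Finite α]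

theorem CoverChain.rk_eq {n : ℕ} {x y : α} (h : CoverChain n x y) : rk x y = n :=
  (coverChain_rk h.le).unique h

theorem rk_self (x : α) : rk x x = 0 := CoverChain.rk_eq (n := 0) rfl

theorem rk_covBy {x c d : α} (hxc : x ≤ c) (hcd : c ⋖ d) : rk x d = rk x c + 1 :=
  CoverChain.rk_eq ⟨c, coverChain_rk hxc, hcd⟩

variable [LocallyFiniteOrder α]

/-- Induction on `d ≥ x` along covering relations. -/
theorem covBy_induction {x : α} {P : α → Prop} (h0 : P x)
    (h1 : ∀ c d, x ≤ c → c ⋖ d → P c → P d) {d : α} (hd : x ≤ d) : P d := by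
  obtain ⟨n, hn⟩ := exists_coverChain d hd
  induction n generalizing d with
  | zero => exact hn ▸ h0
  | succ n ih =>
    obtain ⟨z, hz, hzd⟩ := hn
    exact h1 z d hz.le hzd (ih hz.le hz)

theorem neg_one_pow_rk_mul_mob_nonneg {x d : α} (hd : x ≤ d) :
    0 ≤ (-1) ^ rk x d * mob x d := by
  refine covBy_induction (P := fun d => 0 ≤ (-1) ^ rk x d * mob x d) ?_ ?_ hd
  · simp [rk_self, mob_self]
  · intro c d hxc hcd ih
    rw [rk_covBy hxc hcd, mob_covBy hxc hcd, pow_succ]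
    have := mul_nonneg (Nat.cast_nonneg (α := ℤ) (newAtoms x c d).card) ih
    linarith

theorem abs_mob {x d : α} (hd : x ≤ d) : |mob x d| = (-1) ^ rk x d * mob x d := by
  rw [← abs_of_nonneg (neg_one_pow_rk_mul_mob_nonneg hd), abs_mul, abs_pow, abs_neg, abs_one,
    one_pow, one_mul]

theorem card_newAtoms_self {x d : α} (h : x ⋖ d) : (newAtoms x x d).card = 1 := by
  rw [Finset.card_eq_one]
  refine ⟨d, ?_⟩
  ext a
  rw [mem_newAtoms, Finset.mem_singleton]
  constructor
  · rintro ⟨h1, h2, h3⟩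
    rcases h.eq_or_eq h1.le h2 with h4 | h4
    · exact absurd h4.le h3
    · exact h4
  · rintro rfl
    exact ⟨h, le_rfl, h.lt.not_ge⟩

/-- The sum of the Möbius function over the elements of length at most `n`. -/
noncomputable def truncSum (n : ℕ) (x d : α) : ℤ :=
  ∑ K ∈ Finset.Icc x d, if rk x K ≤ n then mob x K else 0

/-- Joining a new atom raises the length by one, so the cutoff `n + 1` on `a ⊔ K` is the cutoff `n`
on `K`. -/
theorem truncSum_covBy_succ {n : ℕ} {x c d : α} (hxc : x ≤ c) (hcd : c ⋖ d) :
    truncSum (n + 1) x d = truncSum (n + 1) x c - (newAtoms x c d).card * truncSum n x c := by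
  have h := sum_mob_covBy (fun K => if rk x K ≤ n + 1 then 1 else 0) hxc hcd
  simp only [ite_mul, one_mul, zero_mul] at h
  rw [truncSum, h, truncSum, truncSum, Finset.mul_sum]
  congr 1
  refine Finset.sum_congr rfl fun K hK => ?_
  rw [Finset.mem_Icc] at hK
  rw [← nsmul_eq_mul, ← Finset.sum_const]
  refine Finset.sum_congr rfl fun a ha => ?_
  rw [mem_newAtoms] at ha
  rw [rk_covBy hK.1 (covBy_sup_of_newAtom hK.1 ha.1 fun h => ha.2.2 (h.trans hK.2))]
  simp

theorem truncSum_covBy_zero {x c d : α} (hxc : x ≤ c) (hcd : c ⋖ d) :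
    truncSum 0 x d = truncSum 0 x c := by
  have h := sum_mob_covBy (fun K => if rk x K ≤ 0 then 1 else 0) hxc hcd
  simp only [ite_mul, one_mul, zero_mul] at h
  rw [truncSum, h, truncSum, sub_eq_self]
  refine Finset.sum_eq_zero fun K hK => Finset.sum_eq_zero fun a ha => ?_
  rw [Finset.mem_Icc] at hK
  rw [mem_newAtoms] at ha
  rw [rk_covBy hK.1 (covBy_sup_of_newAtom hK.1 ha.1 fun h => ha.2.2 (h.trans hK.2))]
  simp

theorem truncSum_self (n : ℕ) (x : α) : truncSum n x x = 1 := by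
  simp [truncSum, rk_self, mob_self]

open Classical in
/-- Bonferroni inequalities for the Möbius function of a modular lattice. -/
theorem neg_one_pow_mul_truncSum_nonneg (n : ℕ) {x d : α} (hd : x ≤ d) :
    0 ≤ (-1) ^ n * (truncSum n x d - if x = d then 1 else 0) := by
  suffices H : ∀ n, 0 ≤ (-1) ^ n * (truncSum n x d - if x = d then 1 else 0) from H n
  refine covBy_induction
    (P := fun d => ∀ n, 0 ≤ (-1) ^ n * (truncSum n x d - if x = d then 1 else 0)) ?_ ?_ hd
  · simp [truncSum_self]
  · intro c d hxc hcd ih n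
    rw [if_neg (hxc.trans_lt hcd.lt).ne, sub_zero]
    cases n with
    | zero =>
      have := ih 0
      rw [truncSum_covBy_zero hxc hcd]
      split_ifs at this <;> simp_all; omega
    | succ n =>
      rw [truncSum_covBy_succ hxc hcd]
      -- If `d` is an atom over `x`, the recursion reads `1 - 1 = 0`. Otherwise the inductive
      -- inequalities at `n` and `n + 1` enter it with the same sign.
      by_cases h : x = c
      · subst h
        simp [truncSum_self, card_newAtoms_self hcd]
      · have h1 := ih n
        have h2 := ih (n + 1)
        rw [if_neg h, sub_zero] at h1 h2
        have := mul_nonneg (Nat.cast_nonneg (α := ℤ) (newAtoms x c d).card) h1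
        rw [mul_sub]
        have e : (-1 : ℤ) ^ (n + 1) * ((newAtoms x c d).card * truncSum n x c)
          = - ((newAtoms x c d).card * ((-1) ^ n * truncSum n x c)) := by ring
        rw [e]
        linarith

/-- Here `|μ|` is `μ` weighted by the sign of the length; joining an atom flips this sign and turns
the difference in `sum_mob_covBy` into a sum. -/
theorem sum_abs_mob_covBy {x c d : α} (hxc : x ≤ c) (hcd : c ⋖ d) :
    ∑ K ∈ Finset.Icc x d, |mob x K|
      = (1 + (newAtoms x c d).card) * ∑ K ∈ Finset.Icc x c, |mob x K| := by
  have h : ∀ e, ∑ K ∈ Finset.Icc x e, |mob x K|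
      = ∑ K ∈ Finset.Icc x e, (-1) ^ rk x K * mob x K := fun e =>
    Finset.sum_congr rfl fun K hK => abs_mob (Finset.mem_Icc.1 hK).1
  rw [h, h, sum_mob_covBy _ hxc hcd, sub_eq_add_neg, add_mul, one_mul, Finset.mul_sum,
    ← Finset.sum_neg_distrib]
  congr 1
  refine Finset.sum_congr rfl fun K hK => ?_
  rw [Finset.mem_Icc] at hK
  rw [← nsmul_eq_mul, ← Finset.sum_const, ← Finset.sum_neg_distrib]
  refine Finset.sum_congr rfl fun a ha => ?_
  rw [mem_newAtoms] at ha
  rw [rk_covBy hK.1 (covBy_sup_of_newAtom hK.1 ha.1 fun h => ha.2.2 (h.trans hK.2))]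
  ring

theorem abs_mob_covBy {x c d : α} (hxc : x ≤ c) (hcd : c ⋖ d) :
    |mob x d| = (newAtoms x c d).card * |mob x c| := by
  rw [mob_covBy hxc hcd, abs_neg, abs_mul, Nat.abs_cast]

end Rank

/-! ### Semisimple intervals and Loewy length. -/

section Semisimple

variable {α : Type*} [Lattice α] [IsModularLattice α] [Finite α] [LocallyFiniteOrder α]

/-- Nonvanishing of `μ` means that `y` is the join of the atoms of `[x, y]`. If a coatom lies above
all atoms, there are no new atoms and `mob_covBy` gives zero; conversely, climbing by new atoms
multiplies `μ` by nonzero factors. -/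
theorem mob_ne_zero_iff_atoms {x y : α} :
    mob x y ≠ 0 ↔ x ≤ y ∧ ∀ b, x ≤ b → (∀ a, x ⋖ a → a ≤ y → a ≤ b) → y ≤ b := by
  constructor
  · intro h
    refine ⟨le_of_mob_ne_zero h, fun b hxb hb => ?_⟩
    by_contra hyb
    obtain ⟨c, h1, h2⟩ := exists_le_covBy_of_lt (inf_lt_left.2 hyb)
    have hxc : x ≤ c := (le_inf (le_of_mob_ne_zero h) hxb).trans h1
    have he : newAtoms x c y = ∅ := by
      refine Finset.eq_empty_of_forall_notMem fun a ha => ?_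
      rw [mem_newAtoms] at ha
      exact ha.2.2 ((le_inf ha.2.1 (hb a ha.1 ha.2.1)).trans h1)
    rw [mob_covBy hxc h2, he] at h
    simp at h
  · rintro ⟨hxy, H⟩
    obtain ⟨b, hb⟩ := (Set.toFinite {b | x ≤ b ∧ b ≤ y ∧ mob x b ≠ 0}).exists_maximal
      ⟨x, le_rfl, hxy, by simp [mob_self]⟩
    obtain ⟨⟨h1, h2, h3⟩, h4⟩ := hb
    by_cases hyb : y ≤ b
    · rwa [le_antisymm hyb h2]
    · have : ∃ a, x ⋖ a ∧ a ≤ y ∧ ¬ a ≤ b := by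
        by_contra hcon
        push Not at hcon
        exact hyb (H b h1 hcon)
      obtain ⟨a, ha1, ha2, ha3⟩ := this
      have hc := covBy_sup_of_newAtom h1 ha1 ha3
      have hm : mob x (a ⊔ b) ≠ 0 := by
        rw [mob_covBy h1 hc, neg_ne_zero]
        refine mul_ne_zero ?_ h3
        exact_mod_cast (Finset.card_pos.2 ⟨a, mem_newAtoms.2 ⟨ha1, le_sup_left, ha3⟩⟩).ne'
      exact absurd (h4 ⟨h1.trans le_sup_right, sup_le ha2 h2, hm⟩ le_sup_right) hc.lt.not_ge

theorem mob_ne_zero_iff_coatoms {x y : α} :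
    mob x y ≠ 0 ↔ x ≤ y ∧ ∀ b, b ≤ y → (∀ c, c ⋖ y → x ≤ c → b ≤ c) → b ≤ x := by
  rw [← mob_toDual, mob_ne_zero_iff_atoms]
  constructor
  · rintro ⟨h1, h2⟩
    exact ⟨h1, fun b hb h => h2 (OrderDual.toDual b) hb fun a ha hax =>
      h (OrderDual.ofDual a) ha.ofDual hax⟩
  · rintro ⟨h1, h2⟩
    exact ⟨h1, fun b hb h => h2 (OrderDual.ofDual b) hb fun c hc hxc =>
      h (OrderDual.toDual c) hc.toDual hxc⟩

/-- A coatom of `[z, y]` meets `u` either in `u` itself or in a coatom of `[z ⊓ u, u]`. -/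
theorem mob_inf_ne_zero {z y u : α} (h : mob z y ≠ 0) (hu : u ≤ y) : mob (z ⊓ u) u ≠ 0 := by
  rw [mob_ne_zero_iff_coatoms] at h ⊢
  refine ⟨inf_le_right, fun b hb H => le_inf (h.2 b (hb.trans hu) fun c hc hzc => ?_) hb⟩
  by_cases huc : u ≤ c
  · exact hb.trans huc
  · have := inf_covBy_of_covBy hc hu huc
    exact (H (u ⊓ c) this (le_inf inf_le_right (inf_le_left.trans hzc))).trans inf_le_right

theorem mob_ne_zero_of_le {x z y : α} (h : mob x y ≠ 0) (hxz : x ≤ z) (hzy : z ≤ y) :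
    mob x z ≠ 0 := by
  have := mob_inf_ne_zero h hzy
  rwa [inf_eq_left.2 hxz] at this

theorem mob_sup_ne_zero {z y w : α} (h : mob z y ≠ 0) (hw : z ≤ w) : mob w (y ⊔ w) ≠ 0 := by
  rw [mob_ne_zero_iff_atoms] at h ⊢
  refine ⟨le_sup_right, fun b hb H => sup_le (h.2 b (hw.trans hb) fun a ha hay => ?_) hb⟩
  by_cases haw : a ≤ w
  · exact haw.trans hb
  · exact le_sup_left.trans (H _ (covBy_sup_of_newAtom hw ha haw) (sup_le_sup_right hay w))

theorem mob_ne_zero_sup {x y y' : α} (h : mob x y ≠ 0) (h' : mob x y' ≠ 0) :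
    mob x (y ⊔ y') ≠ 0 := by
  rw [mob_ne_zero_iff_atoms] at h h' ⊢
  exact ⟨h.1.trans le_sup_left, fun b hb H => sup_le
    (h.2 b hb fun a ha hay => H a ha (hay.trans le_sup_left))
    (h'.2 b hb fun a ha hay => H a ha (hay.trans le_sup_right))⟩

theorem mob_ne_zero_inf {x x' y : α} (h : mob x y ≠ 0) (h' : mob x' y ≠ 0) :
    mob (x ⊓ x') y ≠ 0 := by
  rw [mob_ne_zero_iff_coatoms] at h h' ⊢
  exact ⟨inf_le_left.trans h.1, fun b hb H => le_inf
    (h.2 b hb fun c hc hxc => H c hc (inf_le_left.trans hxc))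
    (h'.2 b hb fun c hc hxc => H c hc (inf_le_right.trans hxc))⟩

/-- There is a chain of length `k` with semisimple (complemented) steps from `x` to `y`. -/
def LoewyLE : ℕ → α → α → Prop
  | 0, x, y => x = y
  | k + 1, x, y => ∃ z, LoewyLE k x z ∧ mob z y ≠ 0

theorem LoewyLE.le {k : ℕ} {x y : α} (h : LoewyLE k x y) : x ≤ y := by
  induction k generalizing y with
  | zero => exact le_of_eq h
  | succ k ih =>
    obtain ⟨z, h1, h2⟩ := h
    exact (ih h1).trans (le_of_mob_ne_zero h2)

theorem LoewyLE.refl (k : ℕ) (x : α) : LoewyLE k x x := by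
  induction k with
  | zero => rfl
  | succ k ih => exact ⟨x, ih, by simp [mob_self]⟩

theorem LoewyLE.succ {k : ℕ} {x y : α} (h : LoewyLE k x y) : LoewyLE (k + 1) x y :=
  ⟨y, h, by simp [mob_self]⟩

theorem LoewyLE.mono {k l : ℕ} (hkl : k ≤ l) {x y : α} (h : LoewyLE k x y) : LoewyLE l x y := by
  induction hkl with
  | refl => exact h
  | step _ ih => exact ih.succ

theorem LoewyLE.of_le {k : ℕ} {x u y : α} (h : LoewyLE k x y) (hxu : x ≤ u) (huy : u ≤ y) :
    LoewyLE k x u := by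
  induction k generalizing u y with
  | zero => exact le_antisymm hxu (huy.trans (le_of_eq (Eq.symm h)))
  | succ k ih =>
    obtain ⟨z, h1, h2⟩ := h
    exact ⟨z ⊓ u, ih h1 (le_inf h1.le hxu) inf_le_left, mob_inf_ne_zero h2 huy⟩

theorem LoewyLE.sup_right {k : ℕ} {x y : α} (h : LoewyLE k x y) (w : α) :
    LoewyLE k (x ⊔ w) (y ⊔ w) := by
  induction k generalizing y with
  | zero => exact congrArg (· ⊔ w) h
  | succ k ih =>
    obtain ⟨z, h1, h2⟩ := h
    refine ⟨z ⊔ w, ih h1, ?_⟩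
    have := mob_sup_ne_zero h2 (le_sup_left : z ≤ z ⊔ w)
    rwa [← sup_assoc, sup_eq_left.2 (le_of_mob_ne_zero h2)] at this

theorem LoewyLE.sup {k : ℕ} {x y y' : α} (h : LoewyLE k x y) (h' : LoewyLE k x y') :
    LoewyLE k x (y ⊔ y') := by
  induction k generalizing y y' with
  | zero =>
    have h1 : x = y := h
    have h2 : x = y' := h'
    subst h1; subst h2
    rw [sup_idem]; exact LoewyLE.refl 0 x
  | succ k ih =>
    obtain ⟨z, h1, h2⟩ := h
    obtain ⟨z', h1', h2'⟩ := h'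
    refine ⟨z ⊔ z', ih h1 h1', ?_⟩
    have := mob_ne_zero_sup (mob_sup_ne_zero h2 (le_sup_left : z ≤ z ⊔ z'))
      (mob_sup_ne_zero h2' (le_sup_right : z' ≤ z ⊔ z'))
    rwa [sup_sup_sup_comm, sup_idem, sup_sup_sup_comm, sup_eq_left.2 (le_of_mob_ne_zero h2),
      sup_eq_left.2 (le_of_mob_ne_zero h2')] at this

theorem exists_loewyLE {x y : α} (h : x ≤ y) : ∃ k, LoewyLE k x y := by
  refine covBy_induction (P := fun y => ∃ k, LoewyLE k x y) ⟨0, rfl⟩ ?_ h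
  rintro c d - hcd ⟨k, hk⟩
  refine ⟨k + 1, c, hk, ?_⟩
  rw [mob_covBy le_rfl hcd, card_newAtoms_self hcd, mob_self]
  simp

/-- The largest element of Loewy length at most `k` over `g` exists. -/
theorem exists_isGreatest_loewyLE (k : ℕ) (g : α) : ∃ s, IsGreatest {y | LoewyLE k g y} s := by
  obtain ⟨s, hs⟩ := (Set.toFinite {y | LoewyLE k g y}).exists_maximal ⟨g, LoewyLE.refl k g⟩
  exact ⟨s, hs.1, fun y hy => le_sup_right.trans (hs.2 (LoewyLE.sup hs.1 hy) le_sup_left)⟩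

/-- Loewy length over `g` passes to smaller elements, so truncating `t` means meeting it with `s`.
This is the form of condition that Weisner's theorem handles. -/
theorem isGreatest_loewyLE_iff {k : ℕ} {g s φ t : α} (hs : IsGreatest {y | LoewyLE k g y} s)
    (hg : g ≤ φ) (hφ : φ ≤ t) :
    IsGreatest {y | y ≤ t ∧ LoewyLE k g y} φ ↔ t ⊓ s = φ := by
  have h1 : LoewyLE k g (t ⊓ s) := LoewyLE.of_le hs.1 (le_inf (hg.trans hφ) hs.1.le) inf_le_right
  constructor
  · rintro ⟨⟨h2, h3⟩, h4⟩
    exact le_antisymm (h4 ⟨inf_le_left, h1⟩) (le_inf h2 (hs.2 h3))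
  · rintro rfl
    exact ⟨⟨inf_le_left, h1⟩, fun y hy => le_inf hy.1 (hs.2 hy.2)⟩

-- With `s` the largest element of Loewy length at most `k` over `g`, the sum runs over `t` with `t
-- ⊓ s = φ`. If `d ≤ s`, only `t = φ` survives; otherwise `d ⊓ s < d` and Weisner's theorem makes
-- the sum vanish.
open Classical in
theorem sum_mob_loewyLE {k : ℕ} {g φ d : α} (hg : g ≤ φ) :
    ∑ t ∈ Finset.Icc φ d, (if IsGreatest {y | y ≤ t ∧ LoewyLE k g y} φ ∧ LoewyLE (k + 1) g d
      then mob t d else 0) = if LoewyLE k g d then mob φ d else 0 := by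
  by_cases hφd : φ ≤ d
  swap
  · rw [Finset.Icc_eq_empty hφd, Finset.sum_empty]
    by_cases h : mob φ d = 0
    · simp [h]
    · exact absurd (le_of_mob_ne_zero h) hφd
  obtain ⟨s, hs⟩ := exists_isGreatest_loewyLE k g
  have e : ∀ t ∈ Finset.Icc φ d, (if IsGreatest {y | y ≤ t ∧ LoewyLE k g y} φ ∧
      LoewyLE (k + 1) g d then mob t d else 0)
      = if t ⊓ s = φ then (if LoewyLE (k + 1) g d then mob t d else 0) else 0 := by
    intro t ht
    rw [isGreatest_loewyLE_iff hs hg (Finset.mem_Icc.1 ht).1, ite_and]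
  rw [Finset.sum_congr rfl e, ← Finset.sum_filter]
  by_cases hd : LoewyLE k g d
  · simp only [hd, hd.succ, if_true]
    have hds : d ≤ s := hs.2 hd
    have : (Finset.Icc φ d).filter (fun t => t ⊓ s = φ) = {φ} := by
      ext t
      simp only [Finset.mem_filter, Finset.mem_Icc, Finset.mem_singleton]
      constructor
      · rintro ⟨⟨_, h2⟩, h3⟩
        rwa [inf_eq_left.2 (h2.trans hds)] at h3
      · rintro rfl
        exact ⟨⟨le_rfl, hφd⟩, inf_eq_left.2 (hφd.trans hds)⟩
    rw [this, Finset.sum_singleton]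
  · rw [if_neg hd]
    by_cases hd1 : LoewyLE (k + 1) g d
    swap
    · simp [hd1]
    simp only [hd1, if_true]
    have hds : d ⊓ s < d := inf_lt_left.2 fun h => hd (LoewyLE.of_le hs.1 (hg.trans hφd) h)
    have := weisner (x := φ) hds
    rw [← this]
    refine Finset.sum_congr (Finset.filter_congr fun t ht => ?_) fun _ _ => rfl
    rw [← inf_assoc, inf_eq_left.2 (Finset.mem_Icc.1 ht).2]

/-- Both `[t, d]` and `[d ⊓ s, d]` are semisimple, the latter since `d` has Loewy length at most `k
+ 1`; hence so is `[φ, d]`, as `φ = t ⊓ (d ⊓ s)`. -/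
theorem mob_ne_zero_of_loewyLE {k : ℕ} {g φ d t : α} (hg : g ≤ φ) (ht : φ ≤ t)
    (h1 : IsGreatest {y | y ≤ t ∧ LoewyLE k g y} φ) (h2 : LoewyLE (k + 1) g d)
    (h3 : mob t d ≠ 0) : mob φ d ≠ 0 := by
  obtain ⟨s, hs⟩ := exists_isGreatest_loewyLE k g
  rw [isGreatest_loewyLE_iff hs hg ht] at h1
  obtain ⟨z, hz1, hz2⟩ := h2
  have hzs : z ≤ d ⊓ s := le_inf (le_of_mob_ne_zero hz2) (hs.2 hz1)
  have h4 := mob_sup_ne_zero hz2 hzs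
  rw [sup_eq_left.2 inf_le_left] at h4
  have h5 := mob_ne_zero_inf h3 h4
  rwa [← inf_assoc, inf_eq_left.2 (le_of_mob_ne_zero h3), h1] at h5

end Semisimple

/-! ### Perspectivity of atoms and the cubic bound for sums of `|μ|`. -/

section Perspectivity

variable {α : Type*} [Lattice α] [IsModularLattice α]

/-- Perspectivity of atoms over `x`: they are equal, or their join contains a third atom. -/
def Perspective (x p q : α) : Prop :=
  p = q ∨ ∃ s, x ⋖ s ∧ s ≤ p ⊔ q ∧ s ≠ p ∧ s ≠ q

theorem Perspective.symm {x p q : α} (h : Perspective x p q) : Perspective x q p := by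
  rcases h with h | ⟨s, h1, h2, h3, h4⟩
  · exact Or.inl h.symm
  · exact Or.inr ⟨s, h1, sup_comm p q ▸ h2, h4, h3⟩

theorem eq_of_covBy_of_le {x a b : α} (ha : x ⋖ a) (hb : x ⋖ b) (h : a ≤ b) : a = b := by
  rcases hb.eq_or_eq ha.le h with h1 | h1
  · exact absurd h1 ha.lt.ne'
  · exact h1

/-- The exchange property: a line is spanned by any two of its points. -/
theorem le_sup_of_le_sup {x a b c : α} (ha : x ⋖ a) (hb : x ⋖ b) (hc : x ⋖ c) (hca : c ≠ a)
    (h : c ≤ a ⊔ b) : b ≤ a ⊔ c := by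
  have hba : ¬ b ≤ a := fun hba => hca (eq_of_covBy_of_le hc ha (h.trans (sup_le le_rfl hba)))
  have h1 : a ⋖ a ⊔ b := by
    rw [sup_comm]; exact covBy_sup_of_newAtom ha.le hb hba
  have := sup_eq_of_covBy h1 h fun h' => hca (eq_of_covBy_of_le hc ha h')
  rw [sup_comm a c, this]
  exact le_sup_right

/-- A line spanned by two atoms that are not below `K`, one of them below the join of `K` and the
other one, meets `K` in an atom. -/
theorem exists_atom_of_le_sup {x K a p : α} (hK : x ≤ K) (ha : x ⋖ a) (hp : x ⋖ p)
    (haK : ¬ a ≤ K) (hpK : ¬ p ≤ K) (hpa : p ≠ a) (h : p ≤ a ⊔ K) :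
    ∃ k, x ⋖ k ∧ k ≤ K ∧ k ≤ p ⊔ a ∧ k ≠ a ∧ k ≠ p ∧ p ≤ a ⊔ k ∧ a ≤ p ⊔ k := by
  have h1 : K ⋖ a ⊔ K := covBy_sup_of_newAtom hK ha haK
  have h2 : (p ⊔ a) ⊓ K ⋖ p ⊔ a := by
    refine inf_covBy_of_covBy_sup_right ?_
    rwa [sup_assoc, sup_eq_right.2 h]
  have hap : ¬ a ≤ p := fun h' => hpa (eq_of_covBy_of_le ha hp h').symm
  have h3 : p ⋖ p ⊔ a := by rw [sup_comm]; exact covBy_sup_of_newAtom hp.le ha hap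
  have h4 := sup_eq_of_covBy h2 le_sup_left fun h' => hpK (h'.trans inf_le_right)
  have hx : x ≤ (p ⊔ a) ⊓ K := le_inf (hp.le.trans le_sup_left) hK
  have h5 : (p ⊔ a) ⊓ K ⊓ p ⋖ (p ⊔ a) ⊓ K := by
    refine inf_covBy_of_covBy_sup_right ?_
    rwa [sup_comm, h4]
  rw [inf_comm _ p, inf_eq_of_newAtom hx hp fun h' => hpK (h'.trans inf_le_right)] at h5
  have hka : (p ⊔ a) ⊓ K ≠ a := fun h' => haK (h' ▸ inf_le_right)
  have hkp : (p ⊔ a) ⊓ K ≠ p := fun h' => hpK (h' ▸ inf_le_right)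
  exact ⟨_, h5, inf_le_right, inf_le_left, hka, hkp,
    le_sup_of_le_sup ha hp h5 hka (sup_comm p a ▸ inf_le_left),
    le_sup_of_le_sup hp ha h5 hkp inf_le_left⟩

theorem Perspective.trans {x p q r : α} (hp : x ⋖ p) (hq : x ⋖ q) (hr : x ⋖ r)
    (h : Perspective x p q) (h' : Perspective x q r) : Perspective x p r := by
  by_cases hpr : p = r
  · exact Or.inl hpr
  by_cases hpq : p = q
  · exact hpq ▸ h'
  by_cases hqr : q = r
  · exact hqr ▸ h
  obtain ⟨s, hs, hs1, hs2, hs3⟩ := h.resolve_left hpq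
  obtain ⟨t, ht, ht1, ht2, ht3⟩ := h'.resolve_left hqr
  by_cases hrl : r ≤ p ⊔ q
  · exact Or.inr ⟨q, hq, le_sup_of_le_sup hp hq hr (Ne.symm hpr) hrl, Ne.symm hpq, hqr⟩
  have hql : ¬ q ≤ p ⊔ r := fun h1 => hrl (le_sup_of_le_sup hp hr hq (Ne.symm hpq) h1)
  have hmeet : (q ⊔ r) ⊓ (p ⊔ q) = q := by
    rw [sup_inf_assoc_of_le r (le_sup_right : q ≤ p ⊔ q),
      inf_eq_of_newAtom (hp.le.trans le_sup_left) hr hrl, sup_eq_left.2 hq.le]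
  have hnot : ∀ w, x ⋖ w → w ≤ p ⊔ q → w ≤ q ⊔ r → w = q := fun w hw h1 h2 =>
    eq_of_covBy_of_le hw hq (hmeet ▸ le_inf h2 h1)
  have hqs : q ≤ p ⊔ s := le_sup_of_le_sup hp hq hs hs2 hs1
  have hqt : q ≤ r ⊔ t := le_sup_of_le_sup hr hq ht ht3 (sup_comm q r ▸ ht1)
  have hst : t ≠ s := fun h1 => hs3 (hnot s hs hs1 (h1 ▸ ht1))
  have hsK : ¬ s ≤ p ⊔ r := fun h1 => hql (hqs.trans (sup_le le_sup_left h1))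
  have htK : ¬ t ≤ p ⊔ r := fun h1 => hql (hqt.trans (sup_le le_sup_right h1))
  have hle : t ≤ s ⊔ (p ⊔ r) := by
    refine ht1.trans (sup_le (hqs.trans (sup_le ?_ le_sup_left)) ?_)
    · exact le_sup_left.trans le_sup_right
    · exact le_sup_right.trans le_sup_right
  -- Veblen–Young: `s` lies on the line `pq` and `t` on `qr`, so in the plane of `p, q, r` the line
  -- `st` meets `pr` in a point `k`, the required third atom.
  obtain ⟨k, hk, hkK, hkl, -, -, -, -⟩ :=
    exists_atom_of_le_sup (hp.le.trans le_sup_left) hs ht hsK htK hst hle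
  refine Or.inr ⟨k, hk, hkK, ?_, ?_⟩
  · rintro rfl
    have h1 : t ≤ s ⊔ k := le_sup_of_le_sup hs ht hk (Ne.symm hs2) (sup_comm t s ▸ hkl)
    exact ht2 (hnot t ht (h1.trans (sup_le hs1 le_sup_left)) ht1)
  · rintro rfl
    have h1 : s ≤ t ⊔ k := le_sup_of_le_sup ht hs hk (Ne.symm ht3) hkl
    exact hs3 (hnot s hs hs1 (h1.trans (sup_le ht1 le_sup_right)))

/-- Perspectivity on the atoms of `[x, y]`. -/
def perspectiveSetoid (x y : α) : Setoid {a : α // x ⋖ a ∧ a ≤ y} where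
  r p q := Perspective x p.1 q.1
  iseqv :=
    { refl := fun _ => Or.inl rfl
      symm := fun h => h.symm
      trans := fun {p q r} h h' => h.trans p.2.1 q.2.1 r.2.1 h' }

variable [Finite α]

theorem atoms_induction {x y z : α}
    (h : ∀ b, x ≤ b → (∀ a, x ⋖ a → a ≤ y → a ≤ b) → y ≤ b) (hz : x ≤ z) {P : α → Prop}
    (h0 : P z) (hstep : ∀ d a, z ≤ d → d ≤ y ⊔ z → x ⋖ a → a ≤ y → ¬ a ≤ d → P d → P (a ⊔ d)) :
    P (y ⊔ z) := by
  obtain ⟨d, ⟨h1, h2, h3⟩, h4⟩ := (Set.toFinite {d | z ≤ d ∧ d ≤ y ⊔ z ∧ P d}).exists_maximal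
    ⟨z, le_rfl, le_sup_right, h0⟩
  have hyd : y ≤ d := by
    refine h d (hz.trans h1) fun a ha hay => ?_
    by_contra had
    have := h4 (y := a ⊔ d) ⟨h1.trans le_sup_right, sup_le (hay.trans le_sup_left) h2,
      hstep d a h1 h2 ha hay had h3⟩ le_sup_right
    exact had (le_sup_left.trans this)
  rwa [le_antisymm h2 (sup_le hyd h1)] at h3

variable [LocallyFiniteOrder α]

/-- The elements of `[x, y]` whose meets distribute over the joins in `[x, y]`. -/
def IsDistribIn (x y H : α) : Prop :=
  x ≤ H ∧ H ≤ y ∧ ∀ K₁ K₂, x ≤ K₁ → x ≤ K₂ → K₁ ≤ y → K₂ ≤ y →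
    H ⊓ (K₁ ⊔ K₂) = (H ⊓ K₁) ⊔ (H ⊓ K₂)

/-- Take `H` maximal with all its atoms in `U`. Joining an atom `a` of `U` creates only atoms
perspective to `a`, so `H` contains all of `U` in `[x, y]`. Distributivity is checked on atoms:
reach `K₁ ⊔ K₂` from `K₂` by adjoining atoms of `K₁`. If `p ≤ H` appears on adjoining `a ≠ p`, the
line `pa` meets the previous element in `k`; both `a` and `k` are perspective to `p`, hence in `H`.
-/
theorem exists_isDistribIn {x y : α} (h : mob x y ≠ 0) (U : Set α)
    (hU : ∀ a r, x ⋖ a → x ⋖ r → a ≤ y → r ≤ y → Perspective x a r → a ∈ U → r ∈ U) :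
    ∃ H, IsDistribIn x y H ∧ ∀ a, x ⋖ a → a ≤ y → (a ≤ H ↔ a ∈ U) := by
  have hxy := le_of_mob_ne_zero h
  obtain ⟨H, ⟨h1, h2, h3⟩, h4⟩ :=
    (Set.toFinite {d | x ≤ d ∧ d ≤ y ∧ ∀ a, x ⋖ a → a ≤ d → a ∈ U}).exists_maximal
      ⟨x, le_rfl, hxy, fun a ha hax => absurd hax ha.lt.not_ge⟩
  have hmem : ∀ a, x ⋖ a → a ≤ y → (a ≤ H ↔ a ∈ U) := by
    intro a ha hay
    refine ⟨h3 a ha, fun haU => ?_⟩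
    by_contra haH
    refine haH (le_sup_left.trans (h4 (y := a ⊔ H) ⟨h1.trans le_sup_right, sup_le hay h2, ?_⟩
      le_sup_right))
    intro p hp hpaH
    by_cases hpH : p ≤ H
    · exact h3 p hp hpH
    by_cases hpa : p = a
    · exact hpa ▸ haU
    obtain ⟨k, hk, -, hkl, hka, hkp, -, -⟩ := exists_atom_of_le_sup h1 ha hp haH hpH hpa hpaH
    exact hU a p ha hp hay (hpaH.trans (sup_le hay h2))
      (Or.inr ⟨k, hk, sup_comm p a ▸ hkl, hka, hkp⟩) haU
  refine ⟨H, ⟨h1, h2, fun K₁ K₂ hK₁ hK₂ hK₁y hK₂y => ?_⟩, hmem⟩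
  refine le_antisymm ?_ (sup_le (inf_le_inf_left H le_sup_left) (inf_le_inf_left H le_sup_right))
  have hl : mob x (H ⊓ (K₁ ⊔ K₂)) ≠ 0 := mob_ne_zero_of_le h
    (le_inf h1 (hK₁.trans le_sup_left)) (inf_le_left.trans h2)
  have hl1 : mob x K₁ ≠ 0 := mob_ne_zero_of_le h hK₁ hK₁y
  refine (mob_ne_zero_iff_atoms.1 hl).2 _ ((le_inf h1 hK₁).trans le_sup_left) fun p hp hpl => ?_
  suffices hP : ∀ p, x ⋖ p → p ≤ K₁ ⊔ K₂ → p ≤ H → p ≤ (H ⊓ K₁) ⊔ (H ⊓ K₂) from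
    hP p hp (hpl.trans inf_le_right) (hpl.trans inf_le_left)
  refine atoms_induction (P := fun d => ∀ p, x ⋖ p → p ≤ d → p ≤ H → p ≤ (H ⊓ K₁) ⊔ (H ⊓ K₂))
    (mob_ne_zero_iff_atoms.1 hl1).2 hK₂ ?_ ?_
  · exact fun p _ h5 h6 => (le_inf h6 h5).trans le_sup_right
  · intro d a hd hd' ha haK had ih p hp hpad hpH
    by_cases hpd : p ≤ d
    · exact ih p hp hpd hpH
    by_cases hpa : p = a
    · exact (le_inf hpH (hpa ▸ haK)).trans le_sup_left
    obtain ⟨k, hk, hkd, hkl, hka, hkp, hpak, hapk⟩ :=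
      exists_atom_of_le_sup (hK₂.trans hd) ha hp had hpd hpa hpad
    have hpy : p ≤ y := hpH.trans h2
    have hay : a ≤ y := haK.trans hK₁y
    have hky : k ≤ y := hkl.trans (sup_le hpy hay)
    have hpU := (hmem p hp hpy).1 hpH
    have haH : a ≤ H := (hmem a ha hay).2
      (hU p a hp ha hpy hay (Or.inr ⟨k, hk, hkl, hkp, hka⟩) hpU)
    have hkH : k ≤ H := (hmem k hk hky).2
      (hU p k hp hk hpy hky (Or.inr ⟨a, ha, hapk, Ne.symm hpa, Ne.symm hka⟩) hpU)
    exact hpak.trans (sup_le ((le_inf haH haK).trans le_sup_left) (ih k hk hkd hkH))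

theorem two_pow_card_le {x y : α} (h : mob x y ≠ 0) :
    2 ^ Nat.card (Quotient (perspectiveSetoid x y)) ≤ Nat.card {H // IsDistribIn x y H} := by
  classical
  have hfin := Fintype.ofFinite (Quotient (perspectiveSetoid x y))
  have hex : ∀ V : Set (Quotient (perspectiveSetoid x y)), ∃ H, IsDistribIn x y H ∧
      ∀ a : {a : α // x ⋖ a ∧ a ≤ y}, a.1 ≤ H ↔ Quotient.mk _ a ∈ V := by
    intro V
    obtain ⟨H, h1, h2⟩ := exists_isDistribIn h
      {a | ∃ ha : x ⋖ a ∧ a ≤ y, Quotient.mk (perspectiveSetoid x y) ⟨a, ha⟩ ∈ V} (by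
        rintro a r ha hr hay hry hp ⟨_, h3⟩
        refine ⟨⟨hr, hry⟩, ?_⟩
        have : Quotient.mk (perspectiveSetoid x y) ⟨a, ha, hay⟩ = Quotient.mk _ ⟨r, hr, hry⟩ :=
          Quotient.sound hp
        rwa [← this])
    refine ⟨H, h1, fun a => (h2 a.1 a.2.1 a.2.2).trans ⟨?_, fun h3 => ⟨a.2, h3⟩⟩⟩
    rintro ⟨_, h3⟩
    exact h3
  choose f hf1 hf2 using hex
  have hinj : Function.Injective
      (fun V => (⟨f V, hf1 V⟩ : {H // IsDistribIn x y H})) := by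
    intro V W hVW
    have e : f V = f W := congrArg Subtype.val hVW
    ext u
    obtain ⟨a, rfl⟩ := Quotient.exists_rep u
    rw [← hf2, ← hf2, e]
  have := Nat.card_le_card_of_injective _ hinj
  rwa [Nat.card_eq_fintype_card, Fintype.card_set, ← Nat.card_eq_fintype_card] at this

/-- The number of atoms of `[x, d]` in a given perspectivity class of atoms of `[x, y]`. -/
noncomputable def classCount (x y d : α) (u : Quotient (perspectiveSetoid x y)) : ℕ :=
  Nat.card {a : {a : α // x ⋖ a ∧ a ≤ y} // Quotient.mk _ a = u ∧ a.1 ≤ d}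

theorem classCount_mono {x y d e : α} (h : d ≤ e) (u : Quotient (perspectiveSetoid x y)) :
    classCount x y d u ≤ classCount x y e u :=
  Nat.card_le_card_of_injective (fun a => ⟨a.1, a.2.1, a.2.2.trans h⟩) fun a b hab => by
    simpa [Subtype.ext_iff] using hab

/-- Each old atom `r` in the class of `p` yields a third atom on the line `pr`, not below `d`. Lines
through `p` meet `d` in distinct atoms, so these are distinct, and `p` itself is one more. -/
theorem classCount_sup {x y d p : α} (hd : x ≤ d) (hp : x ⋖ p ∧ p ≤ y)
    (hpd : ¬ p ≤ d) :
    classCount x y d (Quotient.mk _ ⟨p, hp⟩) + 1 ≤ (newAtoms x d (p ⊔ d)).card ∧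
    2 * classCount x y d (Quotient.mk _ ⟨p, hp⟩) + 1
      ≤ classCount x y (p ⊔ d) (Quotient.mk _ ⟨p, hp⟩) := by
  classical
  set u := Quotient.mk (perspectiveSetoid x y) ⟨p, hp⟩ with hu
  set B := {a : {a : α // x ⋖ a ∧ a ≤ y} // Quotient.mk (perspectiveSetoid x y) a = u ∧ a.1 ≤ d}
  set N := {a : {a : α // x ⋖ a ∧ a ≤ y} // Quotient.mk (perspectiveSetoid x y) a = u ∧
    a.1 ≤ p ⊔ d ∧ ¬ a.1 ≤ d}
  have hfB : Finite B := inferInstance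
  have hfN : Finite N := inferInstance
  have hg : ∀ r : B, ∃ s : N, s.1.1 ≠ p ∧ s.1.1 ≤ p ⊔ r.1.1 ∧ r.1.1 ≤ p ⊔ s.1.1 := by
    rintro ⟨⟨r, hr, hry⟩, hru, hrd⟩
    have hpr : Perspective x p r := Quotient.exact hru.symm
    have hne : p ≠ r := fun h => hpd (h ▸ hrd)
    obtain ⟨s, hs, hs1, hs2, hs3⟩ := hpr.resolve_left hne
    have hsy : s ≤ y := hs1.trans (sup_le hp.2 hry)
    have hrs : r ≤ p ⊔ s := le_sup_of_le_sup hp.1 hr hs hs2 hs1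
    have hps : Perspective x s p := Or.inr ⟨r, hr, sup_comm p s ▸ hrs, Ne.symm hs3, Ne.symm hne⟩
    refine ⟨⟨⟨s, hs, hsy⟩, Quotient.sound hps, hs1.trans (sup_le_sup_left hrd p), fun hsd => ?_⟩,
      hs2, hs1, hrs⟩
    exact hpd ((le_sup_of_le_sup hr hp.1 hs hs3 (sup_comm p r ▸ hs1)).trans (sup_le hrd hsd))
  choose g hg1 hg2 hg3 using hg
  let g' : Option B → N := fun o => o.elim ⟨⟨p, hp⟩, rfl, le_sup_left, hpd⟩ g
  have hg' : Function.Injective g' := by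
    have hline : ∀ r : B, (p ⊔ r.1.1) ⊓ d = r.1.1 := fun r => by
      rw [sup_comm, sup_inf_assoc_of_le p r.2.2, inf_eq_of_newAtom hd hp.1 hpd,
        sup_eq_left.2 r.1.2.1.le]
    rintro (_ | r) (_ | r') hrr
    · rfl
    · exact absurd (congrArg (fun s => s.1.1) hrr).symm (hg1 r')
    · exact absurd (congrArg (fun s => s.1.1) hrr) (hg1 r)
    · have e : g r = g r' := hrr
      have h1 : r'.1.1 ≤ (p ⊔ r.1.1) ⊓ d :=
        le_inf ((hg3 r').trans (sup_le le_sup_left (e ▸ hg2 r))) r'.2.2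
      rw [hline] at h1
      have := eq_of_covBy_of_le r'.1.2.1 r.1.2.1 h1
      exact congrArg some (Subtype.ext (Subtype.ext this.symm))
  have hcard := Nat.card_le_card_of_injective g' hg'
  rw [Finite.card_option] at hcard
  constructor
  · refine hcard.trans ?_
    rw [← Nat.card_eq_finsetCard]
    refine Nat.card_le_card_of_injective
      (fun s : N => (⟨s.1.1, mem_newAtoms.2 ⟨s.1.2.1, s.2.2.1, s.2.2.2⟩⟩ :
        newAtoms x d (p ⊔ d))) fun a b hab => ?_
    have h1 := congrArg Subtype.val hab
    exact Subtype.ext (Subtype.ext h1)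
  · have h2 : Nat.card (B ⊕ N) ≤ classCount x y (p ⊔ d) u := by
      refine Nat.card_le_card_of_injective (fun s => s.elim
        (fun b => ⟨b.1, b.2.1, b.2.2.trans le_sup_right⟩) (fun n => ⟨n.1, n.2.1, n.2.2.1⟩)) ?_
      rintro (a | a) (b | b) hab
      · have h1 := congrArg Subtype.val hab
        have : a.1 = b.1 := h1
        exact congrArg Sum.inl (Subtype.ext this)
      · have h1 := congrArg Subtype.val hab
        have : a.1 = b.1 := h1
        exact absurd (this ▸ a.2.2) b.2.2.2
      · have h1 := congrArg Subtype.val hab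
        have : a.1 = b.1 := h1
        exact absurd (this ▸ b.2.2) a.2.2.2
      · have h1 := congrArg Subtype.val hab
        have : a.1 = b.1 := h1
        exact congrArg Sum.inr (Subtype.ext this)
    rw [Nat.card_sum] at h2
    change Nat.card B + 1 ≤ Nat.card N at hcard
    change 2 * Nat.card B + 1 ≤ _
    omega

/-- An increasing function bounded by `8` which controls the growth of the sums of absolute values
of the Möbius function. -/
noncomputable def weight (n : ℕ) : ℝ := (2 * (n + 1) / (n + 2)) ^ 3

theorem weight_pos (n : ℕ) : 0 < weight n := by unfold weight; positivity

theorem weight_zero : weight 0 = 1 := by norm_num [weight]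

theorem weight_le (n : ℕ) : weight n ≤ 8 := by
  have : (2 * (n + 1) / (n + 2) : ℝ) ≤ 2 := by
    rw [div_le_iff₀ (by positivity)]; linarith
  calc weight n ≤ 2 ^ 3 := pow_le_pow_left₀ (by positivity) this 3
    _ = 8 := by norm_num

theorem weight_mono : Monotone weight := by
  intro m n h
  refine pow_le_pow_left₀ (by positivity) ?_ 3
  have h' : (m : ℝ) ≤ n := by exact_mod_cast h
  rw [div_le_div_iff₀ (by positivity) (by positivity)]
  nlinarith

/-- Joining an atom multiplies the sum of `|μ|` by `1 + q` but `|μ|` only by `q`; the growth of the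
weight absorbs the difference. In the extremal case `q = n + 1`, `m = 2n + 1` this becomes `(2n + 3)
^ 3 ≤ 8 (n + 1) (n + 2) ^ 2`. -/
theorem weight_step {n m q : ℕ} (hq : n + 1 ≤ q) (hm : 2 * n + 1 ≤ m) :
    (1 + q) * weight n ≤ q * weight m := by
  have h1 : (1 + (n + 1 : ℝ)) * weight n ≤ (n + 1) * weight (2 * n + 1) := by
    unfold weight
    push_cast
    rw [div_pow, div_pow, mul_div_assoc', mul_div_assoc',
      div_le_div_iff₀ (by positivity) (by positivity)]
    have hn : (0 : ℝ) ≤ n := Nat.cast_nonneg n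
    have key : (2 * (n : ℝ) + 1 + 2) ^ 3 ≤ 8 * (n + 1) * (n + 2) ^ 2 := by nlinarith
    calc (1 + ((n : ℝ) + 1)) * (2 * ((n : ℝ) + 1)) ^ 3 * (2 * (n : ℝ) + 1 + 2) ^ 3
        = ((n : ℝ) + 2) * (2 * (n + 1)) ^ 3 * (2 * n + 1 + 2) ^ 3 := by ring
      _ ≤ ((n : ℝ) + 2) * (2 * (n + 1)) ^ 3 * (8 * (n + 1) * (n + 2) ^ 2) :=
          mul_le_mul_of_nonneg_left key (by positivity)
      _ = ((n : ℝ) + 1) * (2 * (2 * n + 1 + 1)) ^ 3 * (n + 2) ^ 3 := by ring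
  have h2 := weight_mono hm
  have h3 : ((n : ℝ) + 1) ≤ q := by exact_mod_cast hq
  have h4 : weight n ≤ weight m := weight_mono (by omega)
  have h5 := weight_pos n
  have h6 : ((n : ℝ) + 1) * weight (2 * n + 1) ≤ (n + 1) * weight m :=
    mul_le_mul_of_nonneg_left h2 (by positivity)
  nlinarith

theorem sum_abs_mob_le {x y : α} (h : mob x y ≠ 0) :
    (∑ K ∈ Finset.Icc x y, |mob x K| : ℤ)
      ≤ |mob x y| * (Nat.card {H // IsDistribIn x y H} : ℤ) ^ 3 := by
  classical
  have hfin := Fintype.ofFinite (Quotient (perspectiveSetoid x y))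
  have hxy := le_of_mob_ne_zero h
  have key : ((∑ K ∈ Finset.Icc x (y ⊔ x), |mob x K| : ℤ) : ℝ)
      ≤ |mob x (y ⊔ x)| * ∏ u, weight (classCount x y (y ⊔ x) u) := by
    refine atoms_induction (P := fun d => ((∑ K ∈ Finset.Icc x d, |mob x K| : ℤ) : ℝ)
      ≤ |mob x d| * ∏ u, weight (classCount x y d u)) (mob_ne_zero_iff_atoms.1 h).2 le_rfl ?_ ?_
    · have : ∀ u, classCount x y x u = 0 := fun u => by
        have : IsEmpty {a : {a : α // x ⋖ a ∧ a ≤ y} //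
          Quotient.mk (perspectiveSetoid x y) a = u ∧ a.1 ≤ x} :=
          ⟨fun a => a.1.2.1.lt.not_ge a.2.2⟩
        exact Nat.card_of_isEmpty
      simp [this, weight_zero, mob_self]
    · intro d p hd _ hp hpy hpd ih
      have hc := covBy_sup_of_newAtom hd hp hpd
      rw [sum_abs_mob_covBy hd hc, abs_mob_covBy hd hc]
      obtain ⟨h1, h2⟩ := classCount_sup hd ⟨hp, hpy⟩ hpd
      set u := Quotient.mk (perspectiveSetoid x y) ⟨p, hp, hpy⟩
      set q := (newAtoms x d (p ⊔ d)).card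
      have h3 := weight_step h1 h2
      -- The class of the joined atom pays for the step; the other factors do not decrease.
      have h4 : (1 + q) * ∏ u, weight (classCount x y d u)
          ≤ q * ∏ u, weight (classCount x y (p ⊔ d) u) := by
        rw [← Finset.mul_prod_erase Finset.univ _ (Finset.mem_univ u),
          ← Finset.mul_prod_erase Finset.univ (fun u => weight (classCount x y (p ⊔ d) u))
            (Finset.mem_univ u), ← mul_assoc, ← mul_assoc]
        refine mul_le_mul h3 (Finset.prod_le_prod (fun _ _ => (weight_pos _).le) fun v _ =>
          weight_mono (classCount_mono le_sup_right v))
          (Finset.prod_nonneg fun _ _ => (weight_pos _).le) ?_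
        exact mul_nonneg (Nat.cast_nonneg _) (weight_pos _).le
      push_cast at ih ⊢
      calc (1 + (q : ℝ)) * ∑ K ∈ Finset.Icc x d, |(mob x K : ℝ)|
          ≤ (1 + q) * (|(mob x d : ℝ)| * ∏ u, weight (classCount x y d u)) :=
            mul_le_mul_of_nonneg_left ih (by positivity)
        _ = |(mob x d : ℝ)| * ((1 + q) * ∏ u, weight (classCount x y d u)) := by ring
        _ ≤ |(mob x d : ℝ)| * (q * ∏ u, weight (classCount x y (p ⊔ d) u)) :=
            mul_le_mul_of_nonneg_left h4 (abs_nonneg _)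
        _ = _ := by ring
  rw [sup_eq_left.2 hxy] at key
  have hprod : ∏ u, weight (classCount x y y u)
      ≤ (Nat.card {H // IsDistribIn x y H} : ℝ) ^ 3 := by
    calc ∏ u, weight (classCount x y y u)
        ≤ ∏ _u : Quotient (perspectiveSetoid x y), (8 : ℝ) :=
          Finset.prod_le_prod (fun _ _ => (weight_pos _).le) fun _ _ => weight_le _
      _ = ((2 : ℝ) ^ Nat.card (Quotient (perspectiveSetoid x y))) ^ 3 := by
          rw [Finset.prod_const, Finset.card_univ, Nat.card_eq_fintype_card, ← pow_mul, mul_comm,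
            pow_mul]
          norm_num
      _ ≤ _ := pow_le_pow_left₀ (by positivity) (by exact_mod_cast two_pow_card_le h) 3
  have := key.trans (mul_le_mul_of_nonneg_left hprod (by positivity))
  exact_mod_cast this

end Perspectivity

/-! ### The cubic bound in the dual order, for the distributive law that defines `Z`. -/

section Dual

variable {α : Type*} [Lattice α] [IsModularLattice α] [Finite α] [LocallyFiniteOrder α]

/-- The elements of `[x, y]` whose joins distribute over the meets in `[x, y]`. -/
def IsCodistribIn (x y H : α) : Prop :=
  x ≤ H ∧ H ≤ y ∧ ∀ K₁ K₂, x ≤ K₁ → x ≤ K₂ → K₁ ≤ y → K₂ ≤ y →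
    H ⊔ (K₁ ⊓ K₂) = (H ⊔ K₁) ⊓ (H ⊔ K₂)

theorem sum_abs_mob_le' {x y : α} (h : mob x y ≠ 0) :
    (∑ K ∈ Finset.Icc x y, |mob K y| : ℤ)
      ≤ |mob x y| * (Nat.card {H // IsCodistribIn x y H} : ℤ) ^ 3 := by
  have h1 := sum_abs_mob_le (x := OrderDual.toDual y) (y := OrderDual.toDual x)
    (by rwa [mob_toDual])
  rw [mob_toDual] at h1
  have h2 : Nat.card {H // IsDistribIn (OrderDual.toDual y) (OrderDual.toDual x) H}
      = Nat.card {H // IsCodistribIn x y H} := by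
    refine Nat.card_congr (Equiv.subtypeEquiv OrderDual.ofDual fun H => ?_)
    constructor
    · rintro ⟨h1, h2, h3⟩
      exact ⟨h2, h1, fun K₁ K₂ a b c d => h3 (OrderDual.toDual K₁) (OrderDual.toDual K₂) c d a b⟩
    · rintro ⟨h1, h2, h3⟩
      exact ⟨h2, h1, fun K₁ K₂ a b c d => h3 (OrderDual.ofDual K₁) (OrderDual.ofDual K₂) c d a b⟩
  rw [h2] at h1
  refine le_trans (le_of_eq ?_) h1
  refine Finset.sum_nbij' OrderDual.toDual OrderDual.ofDual ?_ ?_ ?_ ?_ ?_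
  · intro a ha
    rw [Finset.mem_Icc] at ha ⊢
    exact ⟨ha.2, ha.1⟩
  · intro a ha
    rw [Finset.mem_Icc] at ha ⊢
    exact ⟨ha.2, ha.1⟩
  · exact fun _ _ => rfl
  · exact fun _ _ => rfl
  · intro a _
    rw [mob_toDual]

-- By `mob_ne_zero_of_loewyLE` all terms vanish unless `[φ, d]` is semisimple, which is the case
-- where the cubic bound applies.
open Classical in
theorem sum_abs_mob_loewyLE_le {k : ℕ} {g φ d : α} (hg : g ≤ φ) :
    ∑ t ∈ Finset.Icc φ d, |if IsGreatest {y | y ≤ t ∧ LoewyLE k g y} φ ∧ LoewyLE (k + 1) g d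
      then mob t d else 0| ≤ |mob φ d| * (Nat.card {H // IsCodistribIn φ d H} : ℤ) ^ 3 := by
  by_cases h : mob φ d = 0
  · rw [h, abs_zero, zero_mul]
    refine (Finset.sum_eq_zero fun t ht => ?_).le
    rw [abs_eq_zero, ite_eq_right_iff]
    rintro ⟨h1, h2⟩
    by_contra h3
    exact mob_ne_zero_of_loewyLE hg (Finset.mem_Icc.1 ht).1 h1 h2 h3 h
  · refine le_trans (Finset.sum_le_sum fun t _ => ?_) (sum_abs_mob_le' h)
    split_ifs
    · exact le_rfl
    · simp

end Dual

/-! ### Lattice invariants under embeddings onto lower sets. -/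

section LowerEmbedding

variable {α β : Type*}

/-- Order embeddings whose range is a lower set. -/
structure IsLowerEmbedding [PartialOrder α] [PartialOrder β] (f : α → β) : Prop where
  le_iff : ∀ z w, f z ≤ f w ↔ z ≤ w
  exists_eq : ∀ z y, y ≤ f z → ∃ w, f w = y

namespace IsLowerEmbedding

section PartialOrder

variable [PartialOrder α] [PartialOrder β] {f : α → β}

theorem injective (hf : IsLowerEmbedding f) : Function.Injective f := fun z w h =>
  le_antisymm ((hf.le_iff z w).1 h.le) ((hf.le_iff w z).1 h.ge)

theorem lt_iff (hf : IsLowerEmbedding f) (z w : α) : f z < f w ↔ z < w := by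
  rw [lt_iff_le_not_ge, lt_iff_le_not_ge, hf.le_iff, hf.le_iff]

theorem covBy_iff (hf : IsLowerEmbedding f) (z w : α) : f z ⋖ f w ↔ z ⋖ w := by
  constructor
  · rintro ⟨h1, h2⟩
    exact ⟨(hf.lt_iff z w).1 h1, fun c hc hc' => h2 ((hf.lt_iff z c).2 hc) ((hf.lt_iff c w).2 hc')⟩
  · rintro ⟨h1, h2⟩
    refine ⟨(hf.lt_iff z w).2 h1, fun c hc hc' => ?_⟩
    obtain ⟨c, rfl⟩ := hf.exists_eq w c hc'.le
    exact h2 ((hf.lt_iff z c).1 hc) ((hf.lt_iff c w).1 hc')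

theorem coverChain (hf : IsLowerEmbedding f) {n : ℕ} {x y : α} (h : CoverChain n x y) :
    CoverChain n (f x) (f y) := by
  induction n generalizing y with
  | zero => exact congrArg f h
  | succ n ih =>
    obtain ⟨z, h1, h2⟩ := h
    exact ⟨f z, ih h1, (hf.covBy_iff z y).2 h2⟩

theorem mob_eq [Finite α] [LocallyFiniteOrder α] [LocallyFiniteOrder β] (hf : IsLowerEmbedding f)
    (a b : α) : mob (f a) (f b) = mob a b := by
  by_cases hab : a ≤ b
  · refine mob_eq_of_interval f hab (fun z w _ _ _ _ => hf.le_iff z w) fun y h1 h2 => ?_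
    obtain ⟨w, rfl⟩ := hf.exists_eq b y h2
    exact ⟨w, (hf.le_iff _ _).1 h1, (hf.le_iff _ _).1 h2, rfl⟩
  · have h1 : mob a b = 0 := by_contra fun h => hab (le_of_mob_ne_zero h)
    have h2 : mob (f a) (f b) = 0 :=
      by_contra fun h => hab ((hf.le_iff _ _).1 (le_of_mob_ne_zero h))
    rw [h1, h2]

end PartialOrder

variable [Lattice α] [IsModularLattice α] [Finite α] [LocallyFiniteOrder α]
  [Lattice β] [IsModularLattice β] [Finite β] [LocallyFiniteOrder β] {f : α → β}

theorem rk_eq (hf : IsLowerEmbedding f) {x y : α} (h : x ≤ y) : rk (f x) (f y) = rk x y :=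
  (hf.coverChain (coverChain_rk h)).rk_eq

theorem loewyLE_iff (hf : IsLowerEmbedding f) {k : ℕ} {x y : α} :
    LoewyLE k (f x) (f y) ↔ LoewyLE k x y := by
  induction k generalizing y with
  | zero => exact hf.injective.eq_iff
  | succ k ih =>
    constructor
    · rintro ⟨z, h1, h2⟩
      obtain ⟨z, rfl⟩ := hf.exists_eq y z (le_of_mob_ne_zero h2)
      exact ⟨z, ih.1 h1, by rwa [hf.mob_eq] at h2⟩
    · rintro ⟨z, h1, h2⟩
      exact ⟨f z, ih.2 h1, by rwa [hf.mob_eq]⟩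

theorem isGreatest_iff (hf : IsLowerEmbedding f) {k : ℕ} {g φ t : α} (ht : ∀ y, y ≤ t) :
    IsGreatest {y | y ≤ f t ∧ LoewyLE k (f g) y} (f φ) ↔ IsGreatest {y | LoewyLE k g y} φ := by
  constructor
  · rintro ⟨⟨_, h1⟩, h2⟩
    exact ⟨hf.loewyLE_iff.1 h1, fun y hy => (hf.le_iff _ _).1
      (h2 ⟨(hf.le_iff _ _).2 (ht y), hf.loewyLE_iff.2 hy⟩)⟩
  · rintro ⟨h1, h2⟩
    refine ⟨⟨(hf.le_iff _ _).2 (ht φ), hf.loewyLE_iff.2 h1⟩, ?_⟩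
    rintro y ⟨hy, hy'⟩
    obtain ⟨y, rfl⟩ := hf.exists_eq t y hy
    exact (hf.le_iff _ _).2 (h2 (hf.loewyLE_iff.1 hy'))

end IsLowerEmbedding

end LowerEmbedding

/-! ### Epimorphisms and the lattices of quotients. -/

section Epimorphisms

variable {C : Type u} [Category.{v} C]

/-- Composition of epimorphisms. -/
def EpiHom.comp {X G F : C} (ψ : EpiHom X G) (π : EpiHom G F) : EpiHom X F :=
  ⟨ψ.1 ≫ π.1, haveI := ψ.2; haveI := π.2; epi_comp _ _⟩

/-- An isomorphism as an epimorphism. -/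
def EpiHom.ofIso {G F : C} (e : G ≅ F) : EpiHom G F := ⟨e.hom, inferInstance⟩

theorem EpiHom.comp_left_cancel {X G F : C} (ψ : EpiHom X G) {π π' : EpiHom G F}
    (h : ψ.comp π = ψ.comp π') : π = π' := by
  have := ψ.2
  exact Subtype.ext ((cancel_epi ψ.1).1 (congrArg Subtype.val h))

theorem toQuotient_comp_le {X G F : C} (ψ : EpiHom X G) (π : EpiHom G F) :
    toQuotient (ψ.comp π) ≤ toQuotient ψ :=
  (toQuotient_le_iff _ _).2 ⟨π.1, rfl⟩

theorem exists_comp_eq {X G F : C} {φ : EpiHom X F} {ψ : EpiHom X G}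
    (h : toQuotient φ ≤ toQuotient ψ) : ∃ π : EpiHom G F, ψ.comp π = φ := by
  obtain ⟨π, hπ⟩ := (toQuotient_le_iff _ _).1 h
  have h1 := φ.2
  rw [← hπ] at h1
  exact ⟨⟨π, epi_of_epi ψ.1 π⟩, Subtype.ext hπ⟩

theorem toQuotient_eq_iff {G F H : C} (π : EpiHom G F) (ρ : EpiHom G H) :
    toQuotient π = toQuotient ρ ↔ ∃ e : F ≅ H, π.comp (EpiHom.ofIso e) = ρ := by
  constructor
  · intro h
    obtain ⟨a, ha⟩ := (toQuotient_le_iff _ _).1 h.le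
    obtain ⟨b, hb⟩ := (toQuotient_le_iff _ _).1 h.ge
    have := π.2
    have := ρ.2
    refine ⟨⟨b, a, ?_, ?_⟩, Subtype.ext hb⟩
    · rw [← cancel_epi π.1, reassoc_of% hb, ha, Category.comp_id]
    · rw [← cancel_epi ρ.1, reassoc_of% ha, hb, Category.comp_id]
  · rintro ⟨e, rfl⟩
    refine le_antisymm ((toQuotient_le_iff _ _).2 ⟨e.inv, ?_⟩) (toQuotient_comp_le _ _)
    change (π.1 ≫ e.hom) ≫ e.inv = π.1
    simp

theorem toQuotient_ofIso {G F : C} (e : G ≅ F) : toQuotient (EpiHom.ofIso e) = ⊤ := by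
  refine le_antisymm le_top ?_
  have h : (⊤ : Quotients G) = toQuotient (EpiHom.ofIso (Iso.refl G)) := Subobject.top_eq_id _
  rw [h, toQuotient_le_iff]
  exact ⟨e.inv, e.hom_inv_id⟩

theorem toQuotient_eq_top_iff {G F : C} (π : EpiHom G F) :
    toQuotient π = ⊤ ↔ ∃ e : G ≅ F, EpiHom.ofIso e = π := by
  rw [← toQuotient_ofIso (Iso.refl G), eq_comm, toQuotient_eq_iff]
  have : ∀ e : G ≅ F, (EpiHom.ofIso (Iso.refl G)).comp (EpiHom.ofIso e) = EpiHom.ofIso e :=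
    fun e => Subtype.ext (Category.id_comp _)
  simp_rw [this]

theorem mk_eq_mk_iff {G F : C} : IsoClasses.mk G = IsoClasses.mk F ↔ Nonempty (G ≅ F) :=
  Quotient.eq (r := isIsomorphicSetoid C)

theorem mk_rep (Y : IsoClasses C) : IsoClasses.mk Y.rep = Y := Quotient.out_eq Y

theorem nonempty_rep_iso (G : C) : Nonempty ((IsoClasses.mk G).rep ≅ G) :=
  mk_eq_mk_iff.1 (mk_rep _)

theorem quotientClass_toQuotient {G F : C} (π : EpiHom G F) :
    quotientClass (toQuotient π) = IsoClasses.mk F := by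
  have := π.2
  exact mk_eq_mk_iff.2 ⟨((Subobject.underlyingIso π.1.op).unop).symm⟩

theorem exists_toQuotient_eq {G : C} (x : Quotients G) :
    ∃ π : EpiHom G (quotientClass x).rep, toQuotient π = x := by
  have h1 : toQuotient (G := G) (F := (x : Cᵒᵖ).unop) ⟨x.arrow.unop, inferInstance⟩ = x :=
    Subobject.mk_arrow x
  obtain ⟨e⟩ := nonempty_rep_iso (x : Cᵒᵖ).unop
  refine ⟨EpiHom.comp (F := (quotientClass x).rep) ⟨x.arrow.unop, inferInstance⟩
    (EpiHom.ofIso e.symm), ?_⟩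
  refine Eq.trans ?_ h1
  exact ((toQuotient_eq_iff _ _).2 ⟨e.symm, rfl⟩).symm

/-- The quotients of `G` as quotients of `X`, for an epimorphism from `X` to `G`. -/
noncomputable def pull {X G : C} (ψ : EpiHom X G) (x : Quotients G) : Quotients X :=
  toQuotient (ψ.comp (exists_toQuotient_eq x).choose)

theorem pull_toQuotient {X G F : C} (ψ : EpiHom X G) (π : EpiHom G F) :
    pull ψ (toQuotient π) = toQuotient (ψ.comp π) := by
  obtain ⟨e, he⟩ := (toQuotient_eq_iff _ _).1 (exists_toQuotient_eq (toQuotient π)).choose_spec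
  refine (toQuotient_eq_iff _ _).2 ⟨e, ?_⟩
  conv_rhs => rw [← he]
  exact Subtype.ext (Category.assoc _ _ _)

theorem pull_top {X G : C} (ψ : EpiHom X G) : pull ψ ⊤ = toQuotient ψ := by
  rw [← toQuotient_ofIso (Iso.refl G), pull_toQuotient]
  exact congrArg toQuotient (Subtype.ext (Category.comp_id _))

/-- The quotients of `G` form the part of the quotients of `X` below `ψ`, so Möbius values, lengths
and Loewy lengths can be computed in any `X` above `G`. -/
theorem isLowerEmbedding_pull {X G : C} (ψ : EpiHom X G) : IsLowerEmbedding (pull ψ) where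
  le_iff z w := by
    obtain ⟨π, hπ⟩ := exists_toQuotient_eq z
    obtain ⟨ρ, hρ⟩ := exists_toQuotient_eq w
    rw [← hπ, ← hρ, pull_toQuotient, pull_toQuotient]
    constructor
    · intro h
      obtain ⟨σ, hσ⟩ := exists_comp_eq h
      have : ρ.comp σ = π :=
        ψ.comp_left_cancel (Eq.trans (Subtype.ext (Category.assoc _ _ _).symm) hσ)
      rw [← this]
      exact toQuotient_comp_le _ _
    · intro h
      obtain ⟨σ, rfl⟩ := exists_comp_eq h
      exact (toQuotient_le_iff _ _).2 ⟨σ.1, Category.assoc _ _ _⟩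
  exists_eq z y hy := by
    obtain ⟨π, hπ⟩ := exists_toQuotient_eq z
    obtain ⟨ρ, hρ⟩ := exists_toQuotient_eq y
    rw [← hπ, ← hρ, pull_toQuotient] at hy
    obtain ⟨σ, hσ⟩ := exists_comp_eq (hy.trans (toQuotient_comp_le _ _))
    exact ⟨toQuotient σ, by rw [pull_toQuotient, hσ, hρ]⟩

theorem pull_le {X G : C} (ψ : EpiHom X G) (x : Quotients G) : pull ψ x ≤ toQuotient ψ := by
  rw [← pull_top ψ, (isLowerEmbedding_pull ψ).le_iff]
  exact le_top

theorem isSimpleEpi_of_covBy {G F : C} (π : EpiHom G F) (h : toQuotient π ⋖ ⊤) :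
    IsSimpleEpi π.1 := by
  refine ⟨π.2, fun hiso => ?_, fun H f g hf hg hfg => ?_⟩
  · exact h.lt.ne ((toQuotient_eq_top_iff π).2 ⟨asIso π.1, rfl⟩)
  · have hle : toQuotient π ≤ toQuotient (⟨f, hf⟩ : EpiHom G H) := by
      rw [toQuotient_le_iff]; exact ⟨g, hfg⟩
    rcases h.eq_or_eq hle le_top with h1 | h1
    · right
      obtain ⟨e, he⟩ := (toQuotient_eq_iff _ _).1 h1
      have he' : f ≫ e.hom = π.1 := congrArg Subtype.val he
      have : g = e.hom := by
        rw [← cancel_epi f, hfg, he']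
      rw [this]; infer_instance
    · left
      obtain ⟨e, he⟩ := (toQuotient_eq_top_iff _).1 h1
      have he' : e.hom = f := congrArg Subtype.val he
      rw [← he']; infer_instance

end Epimorphisms

/-! ### Boundedness of Loewy length on a level. -/

section Formations

variable {C : Type u} [Category.{v} C]

theorem IsLevel.isFormation {L : Set (IsoClasses C)} (hL : IsLevel L) : IsFormation L := by
  obtain ⟨B, -, h⟩ := hL
  exact h.1.1

variable [DiamondCategory C]

instance (G : C) : IsModularLattice (Quotients G) := DiamondCategory.modular G

/-- The lattice of quotients of `G` has Loewy length at most `N`. -/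
def LoewyBounded (N : ℕ) (G : C) : Prop := ∀ x : Quotients G, LoewyLE N x ⊤

theorem LoewyBounded.of_epi {N : ℕ} {G F : C} (h : LoewyBounded N G) (π : EpiHom G F) :
    LoewyBounded N F := fun x =>
  (isLowerEmbedding_pull π).loewyLE_iff.1 (LoewyLE.of_le (h (pull π x))
    (((isLowerEmbedding_pull π).le_iff _ _).2 le_top) le_top)

theorem loewyBounded_rep_iff {N : ℕ} {G : C} :
    LoewyBounded N (IsoClasses.mk G).rep ↔ LoewyBounded N G := by
  obtain ⟨e⟩ := nonempty_rep_iso G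
  exact ⟨fun h => h.of_epi (EpiHom.ofIso e), fun h => h.of_epi (EpiHom.ofIso e.symm)⟩

theorem exists_loewyBounded (G : C) : ∃ N, LoewyBounded N G := by
  have h : ∀ x : Quotients G, ∃ N, LoewyLE N x ⊤ := fun x => exists_loewyLE le_top
  choose f hf using h
  obtain ⟨N, hN⟩ := (Set.finite_range f).bddAbove
  exact ⟨N, fun x => (hf x).mono (hN ⟨x, rfl⟩)⟩

/-- The bound holds on `[x ⊓ w, x]`, an interval of quotients of the object of `x`, and is carried
to `[w, x ⊔ w]` by joining with `w`. -/
theorem loewyLE_of_loewyBounded {N : ℕ} {G : C} {x w : Quotients G}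
    (h : LoewyBounded N (quotientClass x).rep) : LoewyLE N w (x ⊔ w) := by
  obtain ⟨π, hπ⟩ := exists_toQuotient_eq x
  have hx : pull π ⊤ = x := by rw [pull_top, hπ]
  obtain ⟨y, hy⟩ := (isLowerEmbedding_pull π).exists_eq ⊤ (x ⊓ w) (inf_le_left.trans hx.ge)
  have := ((isLowerEmbedding_pull π).loewyLE_iff.2 (h y)).sup_right w
  rwa [hy, hx, sup_eq_right.2 inf_le_right] at this

/-- For joins: over any `w ≤ x ⊔ y`, both `x ⊔ w` and `y ⊔ w` have Loewy length at most `N`, hence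
so does their join. A level then inherits the bound from its finitely many generators. -/
theorem isFormation_loewyBounded (N : ℕ) :
    IsFormation {Y : IsoClasses C | LoewyBounded N Y.rep} := by
  refine ⟨fun G x hG => ?_, fun G x y z hz hx hy => ?_, fun G hG => ?_⟩
  · obtain ⟨π, -⟩ := exists_toQuotient_eq x
    exact (loewyBounded_rep_iff.1 hG).of_epi π
  · have hz' : z = x ⊔ y := hz.unique isLUB_pair
    intro w
    obtain ⟨π, hπ⟩ := exists_toQuotient_eq z
    rw [← (isLowerEmbedding_pull π).loewyLE_iff, pull_top, hπ]
    have h := LoewyLE.sup (loewyLE_of_loewyBounded (w := pull π w) hx)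
      (loewyLE_of_loewyBounded (w := pull π w) hy)
    have hw : pull π w ≤ z := (pull_le π w).trans hπ.le
    rw [sup_sup_sup_comm, sup_idem, sup_eq_left.2 (hw.trans hz'.le)] at h
    exact (congrArg (LoewyLE N (pull π w)) hz').mpr h
  · refine loewyBounded_rep_iff.2 fun x => ?_
    rw [hG x]
    exact LoewyLE.refl N ⊤

theorem IsLevel.exists_loewyBounded {L : Set (IsoClasses C)} (hL : IsLevel L) :
    ∃ N, ∀ Y ∈ L, LoewyBounded N Y.rep := by
  obtain ⟨B, hB, h⟩ := hL
  choose f hf using fun Y : IsoClasses C => DiamondMoments.exists_loewyBounded Y.rep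
  obtain ⟨N, hN⟩ := (hB.image f).bddAbove
  refine ⟨N, fun Y hY => h.2 ⟨isFormation_loewyBounded N, fun Z hZ x => ?_⟩ hY⟩
  exact (hf Z x).mono (hN ⟨Z, hZ, rfl⟩)

end Formations

/-! ### Counting epimorphisms, finiteness by length, and countability of levels. -/

section Counting

variable {C : Type u} [Category.{v} C]

/-- The epimorphisms onto `F` from representatives of the elements of `L`. -/
abbrev EpiTo (L : Set (IsoClasses C)) (F : C) := Σ G : L, EpiHom G.1.rep F

/-- The epimorphisms from `X` onto representatives of the elements of `L`. -/
abbrev EpiFrom (L : Set (IsoClasses C)) (X : C) := Σ G : L, EpiHom X G.1.rep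

/-- The automorphisms of `F` act simply transitively on the epimorphisms that define a given
quotient. -/
theorem bijective_comp_ofIso {X F : C} (π₀ : EpiHom X F) :
    Function.Bijective (fun e : Aut F =>
      (⟨π₀.comp (EpiHom.ofIso e), ((toQuotient_eq_iff _ _).2 ⟨e, rfl⟩).symm⟩ :
        {π : EpiHom X F // toQuotient π = toQuotient π₀})) := by
  constructor
  · intro e e' h
    have h1 := congrArg Subtype.val h
    have h2 := congrArg Subtype.val (π₀.comp_left_cancel h1)
    exact Iso.ext h2
  · rintro ⟨π, hπ⟩
    obtain ⟨e, he⟩ := (toQuotient_eq_iff _ _).1 hπ.symm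
    exact ⟨e, Subtype.ext he⟩

/-- A quotient determines its isomorphism class, and the epimorphisms onto the representative form a
torsor under its automorphisms. This is why `1 / |Aut|` weights turn sums over epimorphisms into
sums over quotients. -/
theorem exists_bijective_epiFrom {L : Set (IsoClasses C)} (hL : IsLevel L) {X : C}
    (hX : IsoClasses.mk X ∈ L) (t : Quotients X) :
    ∃ Y : L, ∃ π₀ : EpiHom X Y.1.rep, toQuotient π₀ = t ∧
      ∀ r : EpiFrom L X, toQuotient r.2 = t ↔
        ∃! e : Aut Y.1.rep, r = ⟨Y, π₀.comp (EpiHom.ofIso e)⟩ := by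
  obtain ⟨π₀, hπ₀⟩ := exists_toQuotient_eq t
  refine ⟨⟨quotientClass t, hL.isFormation.1 X t hX⟩, π₀, hπ₀, ?_⟩
  rintro ⟨Y, π⟩
  constructor
  · intro h
    have hY : Y = ⟨quotientClass t, hL.isFormation.1 X t hX⟩ := by
      refine Subtype.ext ?_
      rw [← mk_rep Y.1, ← quotientClass_toQuotient π, h]
    subst hY
    obtain ⟨e, he⟩ := (bijective_comp_ofIso π₀).2 ⟨π, h.trans hπ₀.symm⟩
    have he' := congrArg Subtype.val he
    refine ⟨e, congrArg _ he'.symm, fun e' h' => ?_⟩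
    refine (bijective_comp_ofIso π₀).1 (Subtype.ext ?_)
    exact (eq_of_heq (Sigma.mk.inj h').2).symm.trans he'.symm
  · rintro ⟨e, he, -⟩
    rw [he]
    exact ((toQuotient_eq_iff _ _).2 ⟨e, rfl⟩).symm.trans hπ₀

/-- Two ways to describe a composable pair of epimorphisms. -/
noncomputable def epiToEquiv (L : Set (IsoClasses C)) (F : C) :
    (Σ p : EpiTo L F, EpiTo L p.1.1.rep) ≃
      Σ q : EpiTo L F, {r : EpiFrom L q.1.1.rep // toQuotient q.2 ≤ toQuotient r.2} where
  toFun x := ⟨⟨x.2.1, x.2.2.comp x.1.2⟩, ⟨x.1.1, x.2.2⟩, toQuotient_comp_le _ _⟩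
  invFun y := ⟨⟨y.2.1.1, (exists_comp_eq y.2.2).choose⟩, ⟨y.1.1, y.2.1.2⟩⟩
  left_inv := by
    rintro ⟨⟨T, σ⟩, ⟨H, π⟩⟩
    have h : (exists_comp_eq (toQuotient_comp_le π σ)).choose = σ :=
      π.comp_left_cancel (exists_comp_eq (toQuotient_comp_le π σ)).choose_spec
    exact congrArg (fun s => (⟨⟨T, s⟩, ⟨H, π⟩⟩ : Σ p : EpiTo L F, EpiTo L p.1.1.rep)) h
  right_inv := by
    rintro ⟨⟨H, φ⟩, ⟨⟨T, ψ⟩, h⟩⟩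
    have key : ∀ (φ' : EpiHom H.1.rep F) (h' : toQuotient φ' ≤ toQuotient ψ), φ' = φ →
        (⟨⟨H, φ'⟩, ⟨⟨T, ψ⟩, h'⟩⟩ : Σ q : EpiTo L F,
          {r : EpiFrom L q.1.1.rep // toQuotient q.2 ≤ toQuotient r.2})
        = ⟨⟨H, φ⟩, ⟨⟨T, ψ⟩, h⟩⟩ := by
      rintro φ' h' rfl
      rfl
    exact key _ _ (exists_comp_eq h).choose_spec

/-- Two ways to describe a factorization of an epimorphism from `X` onto `F`. -/
noncomputable def epiFactorEquiv (L : Set (IsoClasses C)) (X F : C) :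
    (Σ p : EpiTo L F, EpiHom X p.1.1.rep) ≃
      Σ φ : EpiHom X F, {r : EpiFrom L X // toQuotient φ ≤ toQuotient r.2} where
  toFun x := ⟨x.2.comp x.1.2, ⟨x.1.1, x.2⟩, toQuotient_comp_le _ _⟩
  invFun y := ⟨⟨y.2.1.1, (exists_comp_eq y.2.2).choose⟩, y.2.1.2⟩
  left_inv := by
    rintro ⟨⟨T, σ⟩, π⟩
    have h : (exists_comp_eq (toQuotient_comp_le π σ)).choose = σ :=
      π.comp_left_cancel (exists_comp_eq (toQuotient_comp_le π σ)).choose_spec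
    exact congrArg (fun s => (⟨⟨T, s⟩, π⟩ : Σ p : EpiTo L F, EpiHom X p.1.1.rep)) h
  right_inv := by
    rintro ⟨φ, ⟨⟨T, ψ⟩, h⟩⟩
    have key : ∀ (φ' : EpiHom X F) (h' : toQuotient φ' ≤ toQuotient ψ), φ' = φ →
        (⟨φ', ⟨⟨T, ψ⟩, h'⟩⟩ : Σ φ : EpiHom X F,
          {r : EpiFrom L X // toQuotient φ ≤ toQuotient r.2}) = ⟨φ, ⟨⟨T, ψ⟩, h⟩⟩ := by
      rintro φ' h' rfl
      rfl
    exact key _ _ (exists_comp_eq h).choose_spec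

variable [DiamondCategory C]

instance (F : C) : Finite (Aut F) := DiamondCategory.finite_aut F

theorem card_aut_ne_zero (F : C) : Nat.card (Aut F) ≠ 0 :=
  haveI : Nonempty (Aut F) := ⟨Iso.refl F⟩
  Nat.card_pos.ne'

instance (X F : C) : Finite (EpiHom X F) := by
  rw [← Set.finite_univ_iff]
  have : (Set.univ : Set (EpiHom X F)) = ⋃ t : Quotients X, {π | toQuotient π = t} := by
    ext π; simp
  rw [this]
  refine Set.finite_iUnion fun t => ?_
  by_cases h : ∃ π₀ : EpiHom X F, toQuotient π₀ = t
  · obtain ⟨π₀, rfl⟩ := h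
    have h1 : Finite {π : EpiHom X F // toQuotient π = toQuotient π₀} :=
      Finite.of_surjective _ (bijective_comp_ofIso π₀).2
    exact h1
  · convert Set.finite_empty
    ext π
    simp only [Set.mem_ofPred_eq, Set.mem_empty_iff_false, iff_false]
    exact fun h' => h ⟨π, h'⟩

theorem finite_epiFrom_fiber {L : Set (IsoClasses C)} (hL : IsLevel L) {X : C}
    (hX : IsoClasses.mk X ∈ L) (t : Quotients X) :
    {r : EpiFrom L X | toQuotient r.2 = t}.Finite := by
  obtain ⟨Y, π₀, -, h⟩ := exists_bijective_epiFrom hL hX t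
  refine (Set.finite_range fun e : Aut Y.1.rep =>
    (⟨Y, π₀.comp (EpiHom.ofIso e)⟩ : EpiFrom L X)).subset fun r hr => ?_
  obtain ⟨e, he, -⟩ := (h r).1 hr
  exact ⟨e, he.symm⟩

theorem finite_epiFrom {L : Set (IsoClasses C)} (hL : IsLevel L) {X : C}
    (hX : IsoClasses.mk X ∈ L) : Finite (EpiFrom L X) := by
  rw [← Set.finite_univ_iff]
  have : (Set.univ : Set (EpiFrom L X)) = ⋃ t : Quotients X, {r | toQuotient r.2 = t} := by
    ext π; simp
  rw [this]
  exact Set.finite_iUnion fun t => finite_epiFrom_fiber hL hX t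

/-- Sums over the quotients of `X` in terms of epimorphisms from `X` weighted by the inverse of the
number of automorphisms. -/
theorem sum_epiFrom {L : Set (IsoClasses C)} (hL : IsLevel L) {X : C}
    (hX : IsoClasses.mk X ∈ L) {R : Type*} [CommSemiring R] (w : ℕ → R)
    (hw : ∀ n : ℕ, n ≠ 0 → n * w n = 1) (φ : Quotients X) (g : Quotients X → R)
    [Fintype {r : EpiFrom L X // φ ≤ toQuotient r.2}] :
    ∑ r : {r : EpiFrom L X // φ ≤ toQuotient r.2},
      g (toQuotient r.1.2) * w (Nat.card (Aut r.1.1.1.rep)) = ∑ t ∈ Finset.Icc φ ⊤, g t := by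
  classical
  rw [← Finset.sum_fiberwise_of_maps_to (s := Finset.univ) (t := Finset.Icc φ ⊤)
    (g := fun r : {r : EpiFrom L X // φ ≤ toQuotient r.2} => toQuotient r.1.2)
    fun r _ => Finset.mem_Icc.2 ⟨r.2, le_top⟩]
  refine Finset.sum_congr rfl fun t ht => ?_
  rw [Finset.mem_Icc] at ht
  obtain ⟨Y, π₀, h0, h⟩ := exists_bijective_epiFrom hL hX t
  have hfin := Fintype.ofFinite (Aut Y.1.rep)
  have hb : ∀ e : Aut Y.1.rep, toQuotient (π₀.comp (EpiHom.ofIso e)) = t := fun e =>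
    ((toQuotient_eq_iff _ _).2 ⟨e, rfl⟩).symm.trans h0
  have : ∑ r : {r : EpiFrom L X // φ ≤ toQuotient r.2} with toQuotient r.1.2 = t,
      g (toQuotient r.1.2) * w (Nat.card (Aut r.1.1.1.rep))
      = ∑ _e : Aut Y.1.rep, g t * w (Nat.card (Aut Y.1.rep)) := by
    symm
    refine Finset.sum_bij (fun e _ => ⟨⟨Y, π₀.comp (EpiHom.ofIso e)⟩, (hb e).symm ▸ ht.1⟩)
      ?_ ?_ ?_ ?_
    · intro e _
      simp only [Finset.mem_filter, Finset.mem_univ, true_and]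
      exact hb e
    · intro e _ e' _ h'
      have h1 := congrArg Subtype.val h'
      obtain ⟨e'', -, h2⟩ := (h ⟨Y, π₀.comp (EpiHom.ofIso e)⟩).1 (hb e)
      exact (h2 e rfl).trans (h2 e' h1).symm
    · rintro ⟨r, hr⟩ hrt
      simp only [Finset.mem_filter, Finset.mem_univ, true_and] at hrt
      obtain ⟨e, he, -⟩ := (h r).1 hrt
      exact ⟨e, Finset.mem_univ _, Subtype.ext he.symm⟩
    · intro e _
      simp only [hb e]
  rw [this, Finset.sum_const, Finset.card_univ, ← Nat.card_eq_fintype_card, nsmul_eq_mul,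
    mul_left_comm, hw _ (card_aut_ne_zero _), mul_one]

theorem sum_mobius {F G : C} [Fintype (EpiHom G F)] :
    ∑ π : EpiHom G F, mobius π = Nat.card (Aut F) * mobiusHat F G := by
  classical
  have hfin := Fintype.ofFinite (Quotient (autSetoid G F))
  have hfinA := Fintype.ofFinite (Aut F)
  rw [mobiusHat, finsum_eq_sum_of_fintype, Finset.mul_sum,
    ← Finset.sum_fiberwise (g := fun π : EpiHom G F => Quotient.mk (autSetoid G F) π)]
  refine Finset.sum_congr rfl fun q _ => ?_
  obtain ⟨π₀, rfl⟩ := Quotient.exists_rep q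
  rw [Quotient.lift_mk, ← nsmul_eq_mul, Nat.card_eq_fintype_card, ← Finset.card_univ,
    ← Finset.sum_const]
  symm
  refine Finset.sum_bij (fun e _ => π₀.comp (EpiHom.ofIso e)) ?_ ?_ ?_ ?_
  · intro e _
    simp only [Finset.mem_filter, Finset.mem_univ, true_and]
    exact (Quotient.sound (s := autSetoid G F) ⟨e, rfl⟩).symm
  · intro e _ e' _ h
    exact (bijective_comp_ofIso π₀).1 (Subtype.ext h)
  · intro π hπ
    simp only [Finset.mem_filter, Finset.mem_univ, true_and] at hπ
    obtain ⟨e, he⟩ := Quotient.exact hπ.symm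
    exact ⟨e, Finset.mem_univ _, Subtype.ext he⟩
  · intro e _
    exact mobius_eq_of_rel _ _ ⟨e, rfl⟩

theorem mobius_eq_mob {G F : C} (π : EpiHom G F) : mobius π = mob (toQuotient π) ⊤ := rfl

theorem mobius_eq_mob_comp {X G F : C} (ψ : EpiHom X G) (π : EpiHom G F) :
    mobius π = mob (toQuotient (ψ.comp π)) (toQuotient ψ) := by
  rw [← pull_toQuotient, ← pull_top ψ, (isLowerEmbedding_pull ψ).mob_eq, mobius_eq_mob]

theorem rk_comp {X G F : C} (ψ : EpiHom X G) (π : EpiHom G F) :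
    rk (toQuotient (ψ.comp π)) (toQuotient ψ) = rk (toQuotient π) ⊤ := by
  rw [← pull_toQuotient, ← pull_top ψ, (isLowerEmbedding_pull ψ).rk_eq le_top]

theorem distributiveCount_eq {G F : C} (π : EpiHom G F) :
    distributiveCount π = Nat.card {H // IsCodistribIn (toQuotient π) ⊤ H} := by
  refine Nat.card_congr (Equiv.subtypeEquivRight fun H => ?_)
  exact ⟨fun h => ⟨h.1, le_top, fun K₁ K₂ h1 h2 _ _ => h.2 K₁ K₂ h1 h2⟩,
    fun h => ⟨h.1, fun K₁ K₂ h1 h2 => h.2.2 K₁ K₂ h1 h2 le_top le_top⟩⟩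

theorem one_le_distributiveCount {G F : C} (π : EpiHom G F) : 1 ≤ distributiveCount π := by
  rw [distributiveCount_eq]
  have : Nonempty {H // IsCodistribIn (toQuotient π) ⊤ H} :=
    ⟨⟨⊤, le_top, le_rfl, fun K₁ K₂ _ _ _ _ => by simp⟩⟩
  exact Nat.card_pos

/-- There are finitely many epimorphisms of a given length onto `F` in a level. -/
theorem finite_rk_eq {L : Set (IsoClasses C)} (hL : IsLevel L) (n : ℕ) {F : C}
    (hF : IsoClasses.mk F ∈ L) :
    {p : EpiTo L F | rk (toQuotient p.2) ⊤ = n}.Finite := by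
  have hfib : ∀ S : Set L, S.Finite → {p : EpiTo L F | p.1 ∈ S}.Finite := by
    intro S hS
    have := hS.to_subtype
    refine (Set.finite_range fun x : Σ G : S, EpiHom G.1.1.rep F =>
      (⟨x.1.1, x.2⟩ : EpiTo L F)).subset ?_
    rintro ⟨G, π⟩ hG
    exact ⟨⟨⟨G, hG⟩, π⟩, rfl⟩
  induction n with
  | zero =>
    refine (hfib {⟨_, hF⟩} (Set.finite_singleton _)).subset ?_
    rintro ⟨G, π⟩ hp
    have h := coverChain_rk (x := toQuotient π) le_top
    rw [show rk (toQuotient π) ⊤ = _ from hp] at h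
    obtain ⟨e, -⟩ := (toQuotient_eq_top_iff π).1 h
    exact Subtype.ext ((mk_rep G.1).symm.trans (mk_eq_mk_iff.2 ⟨e⟩))
  | succ n ih =>
    -- The source of an epimorphism of length `n + 1` has a simple epimorphism to the source of one
    -- of length `n`, so axiom (3) applies to finitely many objects.
    have hfin : (⋃ q ∈ {p : EpiTo L F | rk (toQuotient p.2) ⊤ = n}, {G : L |
        ∃ (H : C) (π : H ⟶ q.1.1.rep), IsoClasses.mk H = G.1 ∧ IsSimpleEpi π}).Finite := by
      refine ih.biUnion fun q _ => ?_
      have h1 := DiamondCategory.finite_simple L hL q.1.1.rep (by rw [mk_rep]; exact q.1.2)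
      refine Set.Finite.of_finite_image (f := Subtype.val) (h1.subset ?_)
        Subtype.val_injective.injOn
      rintro _ ⟨G, hG, rfl⟩
      exact ⟨G.2, hG⟩
    refine (hfib _ hfin).subset ?_
    rintro ⟨G, π⟩ hp
    have h := coverChain_rk (x := toQuotient π) le_top
    rw [show rk (toQuotient π) ⊤ = _ from hp] at h
    obtain ⟨z, h1, h2⟩ := h
    obtain ⟨ψ, hψ⟩ := exists_toQuotient_eq z
    have hT : quotientClass z ∈ L :=
      hL.isFormation.1 _ z (by rw [mk_rep]; exact G.2)
    obtain ⟨ρ, hρ⟩ := exists_comp_eq (h1.le.trans hψ.ge)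
    have hrk : rk (toQuotient ρ) ⊤ = n := by
      rw [← rk_comp ψ ρ, hρ, hψ, h1.rk_eq]
    refine Set.mem_biUnion (x := (⟨⟨_, hT⟩, ρ⟩ : EpiTo L F)) hrk ?_
    exact ⟨G.1.rep, ψ.1, mk_rep G.1, isSimpleEpi_of_covBy ψ (by rwa [hψ])⟩

theorem finite_rk_le {L : Set (IsoClasses C)} (hL : IsLevel L) (n : ℕ) {F : C}
    (hF : IsoClasses.mk F ∈ L) :
    {p : EpiTo L F | rk (toQuotient p.2) ⊤ ≤ n}.Finite := by
  have : {p : EpiTo L F | rk (toQuotient p.2) ⊤ ≤ n}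
      = ⋃ k ∈ Set.Iic n, {p : EpiTo L F | rk (toQuotient p.2) ⊤ = k} := by
    ext p; simp
  rw [this]
  exact (Set.finite_Iic n).biUnion fun k _ => finite_rk_eq hL k hF

/-- A smallest quotient of an object of `L` is a minimal object of `L`. There are countably many of
these, and finitely many epimorphisms of each length onto each. -/
theorem IsLevel.countable {L : Set (IsoClasses C)} (hL : IsLevel L) : L.Countable := by
  have h1 : (⋃ T ∈ {X : IsoClasses C | (∃ G : C, IsMinimalObject G ∧ IsoClasses.mk G = X)} ∩ L,
      ⋃ n : ℕ, (fun p : EpiTo L T.rep => p.1.1) '' {p | rk (toQuotient p.2) ⊤ ≤ n}).Countable := by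
    refine (DiamondCategory.countable_minimal.mono Set.inter_subset_left).biUnion fun T hT => ?_
    refine Set.countable_iUnion fun n => ?_
    exact ((finite_rk_le hL n (by rw [mk_rep]; exact hT.2)).image _).countable
  refine h1.mono fun Y hY => ?_
  obtain ⟨b, hb⟩ := (Set.toFinite (Set.univ : Set (Quotients Y.rep))).exists_minimal ⟨⊤, trivial⟩
  have hb' : ∀ x : Quotients Y.rep, x ≤ b → x = b := fun x hx => le_antisymm hx (hb.2 trivial hx)
  obtain ⟨π, hπ⟩ := exists_toQuotient_eq b
  have hT : quotientClass b ∈ L := hL.isFormation.1 _ b (by rw [mk_rep]; exact hY)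
  have hmin : IsMinimalObject (quotientClass b).rep := by
    intro x
    have h2 := hb' (pull π x) ((pull_le π x).trans hπ.le)
    refine (isLowerEmbedding_pull π).injective ?_
    rw [h2, pull_top, hπ]
  refine Set.mem_biUnion (x := quotientClass b) ⟨⟨_, hmin, mk_rep _⟩, hT⟩ ?_
  refine Set.mem_iUnion.2 ⟨rk (toQuotient π) ⊤, ⟨⟨⟨Y, hY⟩, π⟩, le_refl (rk (toQuotient π) ⊤), rfl⟩⟩

end Counting

/-! ### Truncated series, Bonferroni bounds for measures, and robustness. -/

section Series

variable {C : Type u} [Category.{v} C] [DiamondCategory C] {L : Set (IsoClasses C)}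

/-- The contribution of an epimorphism `π : G ⟶ F` to `|Aut(F)| v_{L, F}`. -/
noncomputable def epiTerm (M : L → ℝ) {F : C} (p : EpiTo L F) : ℝ :=
  (mobius p.2 : ℝ) / (Nat.card (Aut p.1.1.rep) : ℝ) * M p.1

/-- Only `Z ≥ 1` is used here; the cube matters for existence alone. -/
theorem summable_epiTerm {M : L → ℝ} (hM : WellBehaved L M) (F : L) :
    Summable (epiTerm M (F := F.1.rep)) := by
  refine Summable.of_norm_bounded (hM F) fun p => ?_
  rw [epiTerm, Real.norm_eq_abs, abs_mul, abs_div, Nat.abs_cast]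
  refine mul_le_mul_of_nonneg_right ?_ (abs_nonneg _)
  refine le_mul_of_one_le_right (by positivity) ?_
  exact one_le_pow₀ (by exact_mod_cast one_le_distributiveCount p.2)

theorem tsum_epiTerm_fiber (M : L → ℝ) (F G : L) :
    ∑' π : EpiHom G.1.rep F.1.rep, epiTerm M ⟨G, π⟩
      = Nat.card (Aut F.1.rep) * vTerm L M F G := by
  have hfin := Fintype.ofFinite (EpiHom G.1.rep F.1.rep)
  have h : ((∑ π : EpiHom G.1.rep F.1.rep, mobius π : ℤ) : ℝ)
      = Nat.card (Aut F.1.rep) * mobiusHat F.1.rep G.1.rep := by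
    rw [sum_mobius]; push_cast; rfl
  rw [tsum_fintype]
  simp only [epiTerm]
  rw [← Finset.sum_mul, ← Finset.sum_div]
  push_cast at h
  rw [h, vTerm]
  ring

theorem summable_vTerm {M : L → ℝ} (hM : WellBehaved L M) (F : L) : Summable (vTerm L M F) := by
  have h := (summable_epiTerm hM F).sigma
  simp only [tsum_epiTerm_fiber] at h
  exact (summable_mul_left_iff (by exact_mod_cast card_aut_ne_zero F.1.rep)).1 h

theorem hasSum_epiTerm {M : L → ℝ} (hM : WellBehaved L M) (F : L) :
    HasSum (epiTerm M (F := F.1.rep)) (Nat.card (Aut F.1.rep) * vSum L M F) := by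
  have h := (summable_epiTerm hM F).tsum_sigma
  simp only [tsum_epiTerm_fiber] at h
  rw [tsum_mul_left] at h
  rw [vSum, ← h]
  exact (summable_epiTerm hM F).hasSum

/-- The coefficient of the `G`-moment in the truncated sums. -/
noncomputable def coeff {F : C} (p : EpiTo L F) : ℝ :=
  (mobius p.2 : ℝ) * (Nat.card (Aut p.1.1.rep) : ℝ)⁻¹

/-- Group the pairs `X ⟶ G ⟶ F` by their composite `φ`. For fixed `φ` they run over the quotients of
`X` above `φ`, each counted `|Aut(G)|` times, and lengths and Möbius values are read off in `X`. -/
theorem sum_coeff_mul_card (hL : IsLevel L) (n : ℕ) {X F : C} (hX : IsoClasses.mk X ∈ L)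
    (A : Finset (EpiTo L F)) (hA : ∀ p, p ∈ A ↔ rk (toQuotient p.2) ⊤ ≤ n)
    [Fintype (EpiHom X F)] :
    ∑ p ∈ A, coeff p * (Nat.card (EpiHom X p.1.1.rep) : ℝ)
      = ((∑ φ : EpiHom X F, truncSum n (toQuotient φ) ⊤ : ℤ) : ℝ) := by
  classical
  have hfin : ∀ G : L, Fintype (EpiHom X G.1.rep) := fun G => Fintype.ofFinite _
  have hfinR : ∀ φ : EpiHom X F, Fintype {r : EpiFrom L X // toQuotient φ ≤ toQuotient r.2} :=
    fun φ => by
      have := finite_epiFrom hL hX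
      exact Fintype.ofFinite _
  have hfinS : Fintype (Σ p : EpiTo L F, EpiHom X p.1.1.rep) :=
    Fintype.ofEquiv _ (epiFactorEquiv L X F).symm
  have h1 : ∑ p ∈ A, coeff p * (Nat.card (EpiHom X p.1.1.rep) : ℝ)
      = ∑ x : Σ p : EpiTo L F, EpiHom X p.1.1.rep,
        if rk (toQuotient x.1.2) ⊤ ≤ n then coeff x.1 else 0 := by
    have h2 : ∀ p ∈ A, coeff p * (Nat.card (EpiHom X p.1.1.rep) : ℝ)
        = ∑ ψ : EpiHom X p.1.1.rep, if rk (toQuotient p.2) ⊤ ≤ n then coeff p else 0 := by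
      intro p hp
      rw [if_pos ((hA p).1 hp), Finset.sum_const, Finset.card_univ, Nat.card_eq_fintype_card,
        nsmul_eq_mul, mul_comm]
    rw [Finset.sum_congr rfl h2, Finset.sum_sigma']
    refine Finset.sum_subset (Finset.subset_univ _) fun x _ hx => if_neg fun h => hx ?_
    simpa [hA] using h
  rw [h1, ← (epiFactorEquiv L X F).symm.sum_comp, Fintype.sum_sigma, Int.cast_sum]
  refine Finset.sum_congr rfl fun φ _ => ?_
  have h3 := sum_epiFrom hL hX (fun n : ℕ => (n : ℝ)⁻¹)
    (fun n hn => mul_inv_cancel₀ (by exact_mod_cast hn)) (toQuotient φ)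
    (fun t => ((if rk (toQuotient φ) t ≤ n then mob (toQuotient φ) t else 0 : ℤ) : ℝ))
  rw [truncSum, Int.cast_sum, ← h3]
  refine Finset.sum_congr rfl fun r _ => ?_
  have hc := (exists_comp_eq r.2).choose_spec
  change (if rk (toQuotient (exists_comp_eq r.2).choose) ⊤ ≤ n
    then (mobius (exists_comp_eq r.2).choose : ℝ) * (Nat.card (Aut r.1.1.1.rep) : ℝ)⁻¹ else 0) = _
  rw [mobius_eq_mob_comp r.1.2, ← rk_comp r.1.2, hc]
  split_ifs <;> simp

open Classical in
theorem sum_toQuotient_eq_top (X F : L) [Fintype (EpiHom X.1.rep F.1.rep)] :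
    (∑ φ : EpiHom X.1.rep F.1.rep, if toQuotient φ = ⊤ then (1 : ℤ) else 0)
      = if X = F then (Nat.card (Aut F.1.rep) : ℤ) else 0 := by
  split_ifs with h
  · subst h
    have hfin := Fintype.ofFinite (Aut X.1.rep)
    rw [← Finset.sum_filter, Nat.card_eq_fintype_card, ← Finset.card_univ,
      Finset.card_eq_sum_ones, Nat.cast_sum, Nat.cast_one]
    symm
    refine Finset.sum_bij (fun e _ => EpiHom.ofIso e) ?_ ?_ ?_ ?_
    · intro e _
      simpa using toQuotient_ofIso e
    · intro e _ e' _ h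
      exact Iso.ext (congrArg Subtype.val h)
    · intro π hπ
      simp only [Finset.mem_filter, Finset.mem_univ, true_and] at hπ
      obtain ⟨e, he⟩ := (toQuotient_eq_top_iff π).1 hπ
      exact ⟨e, Finset.mem_univ _, he⟩
    · exact fun _ _ => rfl
  · refine Finset.sum_eq_zero fun φ _ => if_neg fun hφ => h ?_
    obtain ⟨e, -⟩ := (toQuotient_eq_top_iff φ).1 hφ
    exact Subtype.ext ((mk_rep X.1).symm.trans ((mk_eq_mk_iff.2 ⟨e⟩).trans (mk_rep F.1)))

open Classical in
theorem neg_one_pow_mul_sum_coeff_nonneg (hL : IsLevel L) (n : ℕ) (X F : L)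
    (A : Finset (EpiTo L F.1.rep)) (hA : ∀ p, p ∈ A ↔ rk (toQuotient p.2) ⊤ ≤ n) :
    0 ≤ (-1) ^ n * (∑ p ∈ A, coeff p * (Nat.card (EpiHom X.1.rep p.1.1.rep) : ℝ)
      - if X = F then (Nat.card (Aut F.1.rep) : ℝ) else 0) := by
  have hfin := Fintype.ofFinite (EpiHom X.1.rep F.1.rep)
  rw [sum_coeff_mul_card hL n (by rw [mk_rep]; exact X.2) A hA]
  have h := sum_toQuotient_eq_top X F
  have h2 : 0 ≤ (-1) ^ n * (∑ φ : EpiHom X.1.rep F.1.rep, truncSum n (toQuotient φ) ⊤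
      - if X = F then (Nat.card (Aut F.1.rep) : ℤ) else 0) := by
    rw [← h, ← Finset.sum_sub_distrib, Finset.mul_sum]
    exact Finset.sum_nonneg fun φ _ => neg_one_pow_mul_truncSum_nonneg n le_top
  have h3 : (0 : ℝ) ≤ (((-1) ^ n * (∑ φ : EpiHom X.1.rep F.1.rep, truncSum n (toQuotient φ) ⊤
      - if X = F then (Nat.card (Aut F.1.rep) : ℤ) else 0) : ℤ) : ℝ) := by exact_mod_cast h2
  push_cast at h3 ⊢
  exact h3

theorem integrable_card {ν : Measure L} {G : L} (h : moment ν G ≠ ⊤) :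
    Integrable (fun X : L => (Nat.card (EpiHom X.1.rep G.1.rep) : ℝ)) ν := by
  simpa using integrable_toReal_of_lintegral_ne_top
    (f := fun X : L => (Nat.card (EpiHom X.1.rep G.1.rep) : ENNReal))
    (Measurable.of_discrete).aemeasurable h

theorem integral_card {ν : Measure L} {G : L} :
    ∫ X : L, (Nat.card (EpiHom X.1.rep G.1.rep) : ℝ) ∂ν = (moment ν G).toReal := by
  have := integral_toReal (μ := ν)
    (f := fun X : L => (Nat.card (EpiHom X.1.rep G.1.rep) : ENNReal))
    (Measurable.of_discrete).aemeasurable (ae_of_all _ fun X => ENNReal.natCast_lt_top _)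
  simpa [moment] using this

/-- The identity of `F` is an epimorphism, so a finite `F`-moment forces finite mass at `F`. -/
theorem measure_singleton_le_moment (ν : Measure L) (F : L) : ν {F} ≤ moment ν F := by
  rw [← lintegral_indicator_one (MeasurableSet.of_discrete : MeasurableSet {F})]
  refine lintegral_mono fun X => ?_
  by_cases h : X = F
  · subst h
    have : Nonempty (EpiHom X.1.rep X.1.rep) := ⟨EpiHom.ofIso (Iso.refl _)⟩
    simpa using Nat.one_le_iff_ne_zero.2 (Nat.card_pos (α := EpiHom X.1.rep X.1.rep)).ne'
  · simp [h]

open Classical in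
theorem neg_one_pow_mul_sum_moment_nonneg (hL : IsLevel L) (n : ℕ) (F : L)
    (A : Finset (EpiTo L F.1.rep)) (hA : ∀ p, p ∈ A ↔ rk (toQuotient p.2) ⊤ ≤ n)
    {ν : Measure L} (hF : moment ν F ≠ ⊤) (hν : ∀ p ∈ A, moment ν p.1 ≠ ⊤) :
    0 ≤ (-1) ^ n * (∑ p ∈ A, coeff p * (moment ν p.1).toReal
      - Nat.card (Aut F.1.rep) * (ν {F}).toReal) := by
  have hfin : ν {F} ≠ ⊤ := ne_top_of_le_ne_top hF (measure_singleton_le_moment ν F)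
  have h0 : 0 ≤ ∫ X : L, (-1 : ℝ) ^ n *
      (∑ p ∈ A, coeff p * (Nat.card (EpiHom X.1.rep p.1.1.rep) : ℝ)
        - if X = F then (Nat.card (Aut F.1.rep) : ℝ) else 0) ∂ν :=
    integral_nonneg fun X => neg_one_pow_mul_sum_coeff_nonneg hL n X F A hA
  have hind : (fun X : L => if X = F then (Nat.card (Aut F.1.rep) : ℝ) else 0)
      = Set.indicator {F} fun _ => (Nat.card (Aut F.1.rep) : ℝ) := by
    ext X; simp [Set.indicator]
  have hi1 : ∀ p ∈ A, Integrable
      (fun X : L => coeff p * (Nat.card (EpiHom X.1.rep p.1.1.rep) : ℝ)) ν :=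
    fun p hp => (integrable_card (hν p hp)).const_mul _
  have hi2 : Integrable (fun X : L => if X = F then (Nat.card (Aut F.1.rep) : ℝ) else 0) ν := by
    rw [hind, integrable_indicator_iff MeasurableSet.of_discrete]
    exact integrableOn_const hfin
  rw [integral_const_mul, integral_sub (integrable_finsetSum _ hi1) hi2,
    integral_finsetSum _ hi1] at h0
  simp only [integral_const_mul, integral_card] at h0
  rw [hind, integral_indicator_const _ MeasurableSet.of_discrete, smul_eq_mul, mul_comm (ν.real _)]
    at h0
  exact h0

theorem tendsto_of_tendsto_moment (hL : IsLevel L) {M : L → ℝ} (hM : WellBehaved L M)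
    {ν : ℕ → Measure L}
    (hν : ∀ G : L, Tendsto (fun t => (moment (ν t) G : EReal)) atTop (𝓝 (M G : EReal))) (F : L) :
    Tendsto (fun t => ((ν t {F} : ENNReal) : EReal)) atTop (𝓝 (vSum L M F : EReal)) := by
  have hA := fun n => finite_rk_le hL n (F := F.1.rep) (by rw [mk_rep]; exact F.2)
  set A : ℕ → Finset (EpiTo L F.1.rep) := fun n => (hA n).toFinset with hAdef
  have hmem : ∀ n p, p ∈ A n ↔ rk (toQuotient p.2) ⊤ ≤ n := fun n p => by simp [hAdef]
  have hAut : (0 : ℝ) < Nat.card (Aut F.1.rep) := by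
    exact_mod_cast Nat.pos_of_ne_zero (card_aut_ne_zero F.1.rep)
  have hreal : ∀ G : L, Tendsto (fun t => (moment (ν t) G).toReal) atTop (𝓝 (M G)) := fun G => by
    have := (EReal.tendsto_toReal (EReal.coe_ne_top (M G)) (EReal.coe_ne_bot (M G))).comp (hν G)
    simpa [Function.comp_def] using this
  -- The moments may be infinite for small `t`, so the inequalities hold only eventually; finitely
  -- many moments are needed for each `n`.
  have htop : ∀ G : L, ∀ᶠ t in atTop, moment (ν t) G ≠ ⊤ := fun G => by
    filter_upwards [(hν G).eventually_lt_const (EReal.coe_lt_top (M G))] with t ht h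
    rw [h] at ht
    simp at ht
  have hAtop : ∀ n, ∀ᶠ t in atTop, ∀ p ∈ A n, moment (ν t) p.1 ≠ ⊤ := fun n =>
    (Finset.eventually_all (A n)).2 fun p _ => htop p.1
  have hlim : ∀ n, Tendsto (fun t => ∑ p ∈ A n, coeff p * (moment (ν t) p.1).toReal) atTop
      (𝓝 (∑ p ∈ A n, epiTerm M p)) := fun n => by
    refine tendsto_finsetSum _ fun p _ => ?_
    rw [epiTerm, div_eq_mul_inv]
    exact (hreal p.1).const_mul _
  have hsum : Tendsto (fun n => ∑ p ∈ A n, epiTerm M p) atTop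
      (𝓝 (Nat.card (Aut F.1.rep) * vSum L M F)) := by
    refine (hasSum_epiTerm hM F).comp (tendsto_atTop_finset_of_monotone ?_ ?_)
    · intro m n hmn p hp
      rw [hmem] at hp ⊢
      exact hp.trans hmn
    · exact fun p => ⟨_, (hmem _ p).2 le_rfl⟩
  have hbound : ∀ n, ∀ᶠ t in atTop, 0 ≤ (-1) ^ n * (∑ p ∈ A n, coeff p * (moment (ν t) p.1).toReal
      - Nat.card (Aut F.1.rep) * (ν t {F}).toReal) := fun n => by
    filter_upwards [hAtop n, htop F] with t h1 h2
    exact neg_one_pow_mul_sum_moment_nonneg hL n F (A n) (hmem n) h2 h1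
  have hmain : Tendsto (fun t => Nat.card (Aut F.1.rep) * (ν t {F}).toReal) atTop
      (𝓝 (Nat.card (Aut F.1.rep) * vSum L M F)) := by
    have htwo : Tendsto (fun k : ℕ => 2 * k) atTop atTop :=
      tendsto_id.const_mul_atTop' (by norm_num)
    -- Odd truncations `2k + 1` bound from below and even ones `2k` from above; `k` is fixed before
    -- `t` is sent to infinity.
    rw [tendsto_order]
    constructor
    · intro a ha
      obtain ⟨k, hk⟩ := ((hsum.comp ((tendsto_add_atTop_nat 1).comp htwo)).eventually_const_lt
        ha).exists
      simp only [Function.comp_apply] at hk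
      filter_upwards [(hlim (2 * k + 1)).eventually_const_lt hk, hbound (2 * k + 1)] with t h1 h2
      rw [Odd.neg_one_pow ⟨k, rfl⟩] at h2
      linarith
    · intro a ha
      obtain ⟨k, hk⟩ := ((hsum.comp htwo).eventually_lt_const ha).exists
      simp only [Function.comp_apply] at hk
      filter_upwards [(hlim (2 * k)).eventually_lt_const hk, hbound (2 * k)] with t h1 h2
      rw [Even.neg_one_pow ⟨k, by ring⟩] at h2
      linarith
  have hfinal : Tendsto (fun t => (ν t {F}).toReal) atTop (𝓝 (vSum L M F)) := by
    have := hmain.const_mul (Nat.card (Aut F.1.rep) : ℝ)⁻¹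
    simpa only [inv_mul_cancel_left₀ hAut.ne'] using this
  refine ((continuous_coe_real_ereal.tendsto _).comp hfinal).congr' ?_
  filter_upwards [htop F] with t ht
  have h1 : ν t {F} ≠ ⊤ := ne_top_of_le_ne_top ht (measure_singleton_le_moment _ F)
  exact EReal.coe_ennreal_toReal h1

end Series

/-! ### Layers by Loewy length and the existence of the measure. -/

section Existence

variable {C : Type u} [Category.{v} C] [DiamondCategory C] {L : Set (IsoClasses C)}

theorem EpiHom.comp_assoc {X G F H : C} (ψ : EpiHom X G) (π : EpiHom G F) (σ : EpiHom F H) :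
    (ψ.comp π).comp σ = ψ.comp (π.comp σ) :=
  Subtype.ext (Category.assoc _ _ _)

open Classical in
/-- If the `M G` are the moments of a measure, the measure-weighted number of epimorphisms from `X`
onto `T` such that `T` is the largest quotient of `X` that has Loewy length at most `k` over `B`. -/
noncomputable def layer (M : L → ℝ) {B : C} (k : ℕ) {T : C} (σ : EpiHom T B) : ℝ :=
  ∑' p : EpiTo L T, if LoewyLE k (toQuotient (p.2.comp σ)) ⊤ then epiTerm M p else 0

open Classical in
/-- The terms of the double series that relates consecutive layers. -/
noncomputable def layerPair (M : L → ℝ) {B : C} (k : ℕ) {T : C} (σ : EpiHom T B)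
    (y : Σ q : EpiTo L T, {r : EpiFrom L q.1.1.rep // toQuotient q.2 ≤ toQuotient r.2}) : ℝ :=
  ((if IsGreatest {z | z ≤ toQuotient y.2.1.2 ∧ LoewyLE k (toQuotient (y.1.2.comp σ)) z}
      (toQuotient y.1.2) ∧ LoewyLE (k + 1) (toQuotient (y.1.2.comp σ)) ⊤
    then mob (toQuotient y.2.1.2) ⊤ else 0 : ℤ) : ℝ) *
    (Nat.card (Aut y.2.1.1.1.rep) : ℝ)⁻¹ * (M y.1.1 / Nat.card (Aut y.1.1.1.rep))

open Classical in
theorem layerPair_epiToEquiv (M : L → ℝ) {B : C} (k : ℕ) {T : C} (σ : EpiHom T B)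
    (p : EpiTo L T) (p' : EpiTo L p.1.1.rep) :
    layerPair M k σ (epiToEquiv L T ⟨p, p'⟩) =
      (if IsGreatest {z | LoewyLE k (toQuotient (p.2.comp σ)) z} (toQuotient p.2) then
        (if LoewyLE (k + 1) (toQuotient (p'.2.comp (p.2.comp σ))) ⊤ then epiTerm M p' else 0)
        else 0) * (Nat.card (Aut p.1.1.rep) : ℝ)⁻¹ := by
  have h1 : IsGreatest {z | z ≤ toQuotient p'.2 ∧
      LoewyLE k (toQuotient ((p'.2.comp p.2).comp σ)) z} (toQuotient (p'.2.comp p.2)) ↔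
      IsGreatest {z | LoewyLE k (toQuotient (p.2.comp σ)) z} (toQuotient p.2) := by
    rw [EpiHom.comp_assoc, ← pull_toQuotient p'.2, ← pull_toQuotient p'.2, ← pull_top p'.2]
    exact (isLowerEmbedding_pull p'.2).isGreatest_iff fun _ => le_top
  change ((if IsGreatest {z | z ≤ toQuotient p'.2 ∧
      LoewyLE k (toQuotient ((p'.2.comp p.2).comp σ)) z} (toQuotient (p'.2.comp p.2)) ∧
      LoewyLE (k + 1) (toQuotient ((p'.2.comp p.2).comp σ)) ⊤
    then mob (toQuotient p'.2) ⊤ else 0 : ℤ) : ℝ) *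
    (Nat.card (Aut p.1.1.rep) : ℝ)⁻¹ * (M p'.1 / Nat.card (Aut p'.1.1.rep)) = _
  rw [h1, EpiHom.comp_assoc, ite_and]
  split_ifs
  · rw [epiTerm, mobius_eq_mob]; ring
  · simp
  · simp

theorem mk_rep_mem (G : L) : IsoClasses.mk G.1.rep ∈ L := by
  rw [mk_rep]; exact G.2

/-- For a fixed composite `q`, the sum over intermediate quotients is bounded by `|μ(q)| Z(q) ^ 3`,
giving exactly the term of the well-behavedness series at `T`. -/
theorem summable_layerPair (hL : IsLevel L) {M : L → ℝ} (hM : WellBehaved L M) {B : C} (k : ℕ)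
    {T : L} (σ : EpiHom T.1.rep B) : Summable (layerPair M k σ) := by
  classical
  rw [← summable_abs_iff, summable_sigma_of_nonneg fun _ => abs_nonneg _]
  have hfin : ∀ q : EpiTo L T.1.rep,
      Finite {r : EpiFrom L q.1.1.rep // toQuotient q.2 ≤ toQuotient r.2} := fun q => by
    have := finite_epiFrom hL (mk_rep_mem q.1)
    infer_instance
  refine ⟨fun q => by
      have := hfin q
      exact Summable.of_finite,
    Summable.of_nonneg_of_le (fun q => tsum_nonneg fun _ => abs_nonneg _) (fun q => ?_) (hM T)⟩
  have hft := Fintype.ofFinite {r : EpiFrom L q.1.1.rep // toQuotient q.2 ≤ toQuotient r.2}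
  rw [tsum_fintype]
  have h1 := sum_epiFrom hL (mk_rep_mem q.1) (fun n : ℕ => (n : ℝ)⁻¹)
    (fun n hn => mul_inv_cancel₀ (by exact_mod_cast hn)) (toQuotient q.2)
    (fun t => ((|if IsGreatest {z | z ≤ t ∧ LoewyLE k (toQuotient (q.2.comp σ)) z}
      (toQuotient q.2) ∧ LoewyLE (k + 1) (toQuotient (q.2.comp σ)) ⊤
      then mob t ⊤ else 0| : ℤ) : ℝ))
  have h2 := sum_abs_mob_loewyLE_le (k := k) (d := ⊤) (toQuotient_comp_le q.2 σ)
  rw [← distributiveCount_eq, ← mobius_eq_mob] at h2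
  have h3 : ∀ r : {r : EpiFrom L q.1.1.rep // toQuotient q.2 ≤ toQuotient r.2},
      |layerPair M k σ ⟨q, r⟩| = ((|if IsGreatest {z | z ≤ toQuotient r.1.2 ∧
        LoewyLE k (toQuotient (q.2.comp σ)) z}
        (toQuotient q.2) ∧ LoewyLE (k + 1) (toQuotient (q.2.comp σ)) ⊤
        then mob (toQuotient r.1.2) ⊤ else 0| : ℤ) : ℝ) * (Nat.card (Aut r.1.1.1.rep) : ℝ)⁻¹
        * (|M q.1| / Nat.card (Aut q.1.1.rep)) := fun r => by
    rw [layerPair, abs_mul, abs_mul, abs_inv, abs_div, Nat.abs_cast, Nat.abs_cast, Int.cast_abs]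
  rw [Finset.sum_congr rfl fun r _ => h3 r, ← Finset.sum_mul, h1]
  have h4 : (∑ t ∈ Finset.Icc (toQuotient q.2) ⊤,
      ((|if IsGreatest {z | z ≤ t ∧ LoewyLE k (toQuotient (q.2.comp σ)) z}
      (toQuotient q.2) ∧ LoewyLE (k + 1) (toQuotient (q.2.comp σ)) ⊤
      then mob t ⊤ else 0| : ℤ) : ℝ)) ≤ |(mobius q.2 : ℝ)| * (distributiveCount q.2 : ℝ) ^ 3 := by
    exact_mod_cast h2
  calc _ ≤ |(mobius q.2 : ℝ)| * (distributiveCount q.2 : ℝ) ^ 3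
        * (|M q.1| / Nat.card (Aut q.1.1.rep)) :=
        mul_le_mul_of_nonneg_right h4 (by positivity)
    _ = _ := by ring

theorem tsum_layerPair (hL : IsLevel L) {M : L → ℝ} (hM : WellBehaved L M) {B : C} (k : ℕ)
    {T : L} (σ : EpiHom T.1.rep B) : ∑' y, layerPair M k σ y = layer M k σ := by
  classical
  rw [(summable_layerPair hL hM k σ).tsum_sigma, layer]
  refine tsum_congr fun q => ?_
  have := finite_epiFrom hL (mk_rep_mem q.1)
  have hft := Fintype.ofFinite {r : EpiFrom L q.1.1.rep // toQuotient q.2 ≤ toQuotient r.2}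
  have h1 := sum_epiFrom hL (mk_rep_mem q.1) (fun n : ℕ => (n : ℝ)⁻¹)
    (fun n hn => mul_inv_cancel₀ (by exact_mod_cast hn)) (toQuotient q.2)
    (fun t => ((if IsGreatest {z | z ≤ t ∧ LoewyLE k (toQuotient (q.2.comp σ)) z}
      (toQuotient q.2) ∧ LoewyLE (k + 1) (toQuotient (q.2.comp σ)) ⊤
      then mob t ⊤ else 0 : ℤ) : ℝ))
  rw [tsum_fintype]
  simp only [layerPair]
  rw [← Finset.sum_mul, h1, ← Int.cast_sum, sum_mob_loewyLE (toQuotient_comp_le q.2 σ), epiTerm,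
    mobius_eq_mob]
  split_ifs
  · ring
  · simp

-- Both sides are iterated sums of `layerPair`. Summing over intermediate objects first gives `layer
-- M k σ` by `sum_mob_loewyLE`; summing over the outer source first gives the next layer.
open Classical in
theorem hasSum_layer (hL : IsLevel L) {M : L → ℝ} (hM : WellBehaved L M) {B : C} (k : ℕ)
    {T : L} (σ : EpiHom T.1.rep B) :
    HasSum (fun p : EpiTo L T.1.rep =>
      (if IsGreatest {z | LoewyLE k (toQuotient (p.2.comp σ)) z} (toQuotient p.2) then
        layer M (k + 1) (p.2.comp σ) else 0) * (Nat.card (Aut p.1.1.rep) : ℝ)⁻¹)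
      (layer M k σ) := by
  have hs := ((epiToEquiv L T.1.rep).summable_iff (f := layerPair M k σ)).2
    (summable_layerPair hL hM k σ)
  have ht := (epiToEquiv L T.1.rep).tsum_eq (layerPair M k σ)
  rw [tsum_layerPair hL hM] at ht
  have hinner : ∀ p : EpiTo L T.1.rep,
      ∑' p' : EpiTo L p.1.1.rep, layerPair M k σ (epiToEquiv L T.1.rep ⟨p, p'⟩)
      = (if IsGreatest {z | LoewyLE k (toQuotient (p.2.comp σ)) z} (toQuotient p.2) then
        layer M (k + 1) (p.2.comp σ) else 0) * (Nat.card (Aut p.1.1.rep) : ℝ)⁻¹ := by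
    intro p
    simp only [layerPair_epiToEquiv]
    rw [tsum_mul_right]
    congr 1
    split_ifs
    · rfl
    · exact tsum_zero
  have h1 := hs.sigma
  have h2 := hs.tsum_sigma
  simp only [Function.comp_apply, hinner] at h1 h2
  rw [← ht, h2]
  exact h1.hasSum

theorem layer_of_loewyBounded {M : L → ℝ} (hM : WellBehaved L M) {B : C} {N : ℕ}
    (hN : ∀ Y ∈ L, LoewyBounded N Y.rep) {T : L} (σ : EpiHom T.1.rep B) :
    layer M N σ = Nat.card (Aut T.1.rep) * vSum L M T := by
  rw [← (hasSum_epiTerm hM T).tsum_eq, layer]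
  refine tsum_congr fun p => if_pos ?_
  exact hN _ p.1.2 _

theorem layer_nonneg (hL : IsLevel L) {M : L → ℝ} (hM : WellBehaved L M) {B : C} {N : ℕ}
    (hN : ∀ Y ∈ L, LoewyBounded N Y.rep) (hv : ∀ F : L, 0 ≤ vSum L M F) {k : ℕ} (hk : k ≤ N) :
    ∀ {T : L} (σ : EpiHom T.1.rep B), 0 ≤ layer M k σ := by
  induction hk using Nat.decreasingInduction with
  | self =>
    intro T σ
    rw [layer_of_loewyBounded hM hN]
    exact mul_nonneg (Nat.cast_nonneg _) (hv T)
  | of_succ k _ ih =>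
    intro T σ
    rw [← (hasSum_layer hL hM k σ).tsum_eq]
    refine tsum_nonneg fun p => mul_nonneg ?_ (by positivity)
    split_ifs
    · exact ih _
    · exact le_rfl

/-- Loewy length zero leaves only the automorphisms of `B`, each contributing `M B / |Aut(B)|`. -/
theorem layer_zero (M : L → ℝ) (B : L) : layer M 0 (EpiHom.ofIso (Iso.refl B.1.rep)) = M B := by
  classical
  have hfin := Fintype.ofFinite (Aut B.1.rep)
  have hinj : Function.Injective
      (fun e : Aut B.1.rep => (⟨B, EpiHom.ofIso e⟩ : EpiTo L B.1.rep)) := by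
    intro e e' h
    exact Iso.ext (congrArg Subtype.val (eq_of_heq (Sigma.mk.inj h).2))
  have hid : ∀ p : EpiTo L B.1.rep, p.2.comp (EpiHom.ofIso (Iso.refl B.1.rep)) = p.2 :=
    fun p => Subtype.ext (Category.comp_id _)
  rw [layer]
  simp only [hid]
  rw [← hinj.tsum_eq]
  · have h : ∀ e : Aut B.1.rep, (if LoewyLE 0 (toQuotient (EpiHom.ofIso e)) ⊤ then
        epiTerm M (⟨B, EpiHom.ofIso e⟩ : EpiTo L B.1.rep) else 0)
        = (Nat.card (Aut B.1.rep) : ℝ)⁻¹ * M B := by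
      intro e
      rw [if_pos (show LoewyLE 0 (toQuotient (EpiHom.ofIso e)) ⊤ from toQuotient_ofIso e)]
      have h1 : mobius (EpiHom.ofIso (G := B.1.rep) (F := B.1.rep) e) = 1 :=
        (congrArg (fun x => mob x ⊤) (toQuotient_ofIso e)).trans (mob_self _)
      change (mobius (EpiHom.ofIso (G := B.1.rep) (F := B.1.rep) e) : ℝ) /
        (Nat.card (Aut B.1.rep) : ℝ) * M B = _
      rw [h1, Int.cast_one, one_div]
    simp only [h]
    rw [tsum_fintype, Finset.sum_const, Finset.card_univ, Nat.card_eq_fintype_card, nsmul_eq_mul,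
      ← mul_assoc, mul_inv_cancel₀, one_mul]
    rw [← Nat.card_eq_fintype_card]
    exact_mod_cast card_aut_ne_zero B.1.rep
  · rintro ⟨G, π⟩ hp
    have hp' : LoewyLE 0 (toQuotient π) ⊤ := by
      by_contra h
      exact hp (if_neg h)
    obtain ⟨e, rfl⟩ := (toQuotient_eq_top_iff π).1 hp'
    have hG : G = B :=
      Subtype.ext ((mk_rep G.1).symm.trans ((mk_eq_mk_iff.2 ⟨e⟩).trans (mk_rep B.1)))
    subst hG
    exact ⟨e, rfl⟩

open Classical in
theorem ofReal_layer (hL : IsLevel L) {M : L → ℝ} (hM : WellBehaved L M) {B : C} (k : ℕ)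
    (hpos : ∀ {T : L} (σ : EpiHom T.1.rep B), 0 ≤ layer M (k + 1) σ)
    {T : L} (σ : EpiHom T.1.rep B) :
    ENNReal.ofReal (layer M k σ) = ∑' p : EpiTo L T.1.rep,
      (if IsGreatest {z | LoewyLE k (toQuotient (p.2.comp σ)) z} (toQuotient p.2) then
        ENNReal.ofReal (layer M (k + 1) (p.2.comp σ)) else 0) *
          (Nat.card (Aut p.1.1.rep) : ENNReal)⁻¹ := by
  have hnn : ∀ p : EpiTo L T.1.rep,
      0 ≤ (if IsGreatest {z | LoewyLE k (toQuotient (p.2.comp σ)) z} (toQuotient p.2) then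
        layer M (k + 1) (p.2.comp σ) else 0) := fun p => by
    split_ifs
    · exact hpos _
    · exact le_rfl
  rw [← (hasSum_layer hL hM k σ).tsum_eq, ENNReal.ofReal_tsum_of_nonneg
    (fun p => mul_nonneg (hnn p) (by positivity)) (hasSum_layer hL hM k σ).summable]
  refine tsum_congr fun p => ?_
  have hc : (0 : ℝ) < Nat.card (Aut p.1.1.rep) := by
    exact_mod_cast Nat.pos_of_ne_zero (card_aut_ne_zero p.1.1.rep)
  rw [ENNReal.ofReal_mul (hnn p), ENNReal.ofReal_inv_of_pos hc, ENNReal.ofReal_natCast]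
  congr 1
  split_ifs <;> simp

theorem natCast_mul_inv_cancel (n : ℕ) (hn : n ≠ 0) : (n : ENNReal) * (n : ENNReal)⁻¹ = 1 :=
  ENNReal.mul_inv_cancel (by exact_mod_cast hn) (ENNReal.natCast_ne_top n)

/-- Expand each layer by `ofReal_layer` and regroup by the composite onto `B`, which is free in `[0,
∞]`. Every composite has exactly one largest intermediate quotient of Loewy length at most `k` over
`B`, so it is counted once. -/
theorem tsum_layer_succ (hL : IsLevel L) {M : L → ℝ} (hM : WellBehaved L M) {B : C} (k : ℕ)
    (hpos : ∀ {T : L} (σ : EpiHom T.1.rep B), 0 ≤ layer M (k + 1) σ) :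
    ∑' p : EpiTo L B, ENNReal.ofReal (layer M k p.2) * (Nat.card (Aut p.1.1.rep) : ENNReal)⁻¹
      = ∑' p : EpiTo L B,
        ENNReal.ofReal (layer M (k + 1) p.2) * (Nat.card (Aut p.1.1.rep) : ENNReal)⁻¹ := by
  classical
  let f : (Σ q : EpiTo L B, {r : EpiFrom L q.1.1.rep // toQuotient q.2 ≤ toQuotient r.2}) →
      ENNReal := fun y => (if IsGreatest {z | LoewyLE k (toQuotient y.1.2) z} (toQuotient y.2.1.2)
        then ENNReal.ofReal (layer M (k + 1) y.1.2) else 0) *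
        (Nat.card (Aut y.1.1.1.rep) : ENNReal)⁻¹ * (Nat.card (Aut y.2.1.1.1.rep) : ENNReal)⁻¹
  have h1 : ∑' p : EpiTo L B,
      ENNReal.ofReal (layer M k p.2) * (Nat.card (Aut p.1.1.rep) : ENNReal)⁻¹
      = ∑' y, f y := by
    rw [← (epiToEquiv L B).tsum_eq f]
    refine Eq.trans (tsum_congr fun p : EpiTo L B => ?_)
      (ENNReal.tsum_sigma fun p p' => f (epiToEquiv L B ⟨p, p'⟩)).symm
    rw [ofReal_layer hL hM k hpos, ← ENNReal.tsum_mul_right]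
    rfl
  rw [h1, ENNReal.tsum_sigma']
  refine tsum_congr fun q => ?_
  have := finite_epiFrom hL (mk_rep_mem q.1)
  have hft := Fintype.ofFinite {r : EpiFrom L q.1.1.rep // toQuotient q.2 ≤ toQuotient r.2}
  have h2 := sum_epiFrom hL (mk_rep_mem q.1) (fun n : ℕ => (n : ENNReal)⁻¹)
    natCast_mul_inv_cancel (toQuotient q.2)
    (fun t => if IsGreatest {z | LoewyLE k (toQuotient q.2) z} t then
      ENNReal.ofReal (layer M (k + 1) q.2) * (Nat.card (Aut q.1.1.rep) : ENNReal)⁻¹ else 0)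
  rw [tsum_fintype]
  simp only [f]
  simp only [ite_mul, zero_mul] at h2 ⊢
  rw [h2]
  obtain ⟨s, hs⟩ := exists_isGreatest_loewyLE k (toQuotient q.2)
  have : ∀ t, IsGreatest {z | LoewyLE k (toQuotient q.2) z} t ↔ t = s := fun t =>
    ⟨fun h => h.unique hs, fun h => h ▸ hs⟩
  simp only [this]
  rw [Finset.sum_ite_eq' (Finset.Icc _ _), if_pos (Finset.mem_Icc.2 ⟨hs.1.le, le_top⟩)]

theorem ofReal_moment_eq_tsum (hL : IsLevel L) {M : L → ℝ} (hM : WellBehaved L M)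
    (hv : ∀ F : L, 0 ≤ vSum L M F) (B : L) :
    0 ≤ M B ∧ ENNReal.ofReal (M B) = ∑' F : L,
      ENNReal.ofReal (vSum L M F) * (Nat.card (EpiHom F.1.rep B.1.rep) : ENNReal) := by
  classical
  -- A positive bound is chosen because the iteration starts at layer `1`: the first step expands
  -- the single layer `0` of the identity of `B`.
  obtain ⟨N, hN⟩ : ∃ N, ∀ Y ∈ L, LoewyBounded (N + 1) Y.rep := by
    obtain ⟨N, hN⟩ := hL.exists_loewyBounded
    exact ⟨N, fun Y hY x => (hN Y hY x).succ⟩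
  refine ⟨layer_zero M B ▸ layer_nonneg hL hM hN hv (Nat.zero_le _) _, ?_⟩
  have hstep : ∀ k ≤ N, ENNReal.ofReal (M B) = ∑' p : EpiTo L B.1.rep,
      ENNReal.ofReal (layer M (k + 1) p.2) * (Nat.card (Aut p.1.1.rep) : ENNReal)⁻¹ := by
    intro k
    induction k with
    | zero =>
      intro _
      rw [← layer_zero M B, ofReal_layer hL hM 0 fun σ =>
        layer_nonneg hL hM hN hv (Nat.succ_le_succ (Nat.zero_le N)) σ]
      refine tsum_congr fun p => ?_
      have hid : p.2.comp (EpiHom.ofIso (Iso.refl B.1.rep)) = p.2 :=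
        Subtype.ext (Category.comp_id _)
      -- At `k = 0` the set is the singleton of the quotient itself, so the maximality condition is
      -- automatic.
      rw [hid, if_pos]
      exact ⟨rfl, fun y hy => (Eq.symm hy).le⟩
    | succ k ih =>
      intro hk
      rw [ih (Nat.le_of_succ_le hk)]
      exact tsum_layer_succ hL hM (k + 1) fun σ =>
        layer_nonneg hL hM hN hv (Nat.succ_le_succ hk) σ
  rw [hstep N le_rfl, ENNReal.tsum_sigma']
  refine tsum_congr fun F => ?_
  have hft := Fintype.ofFinite (EpiHom F.1.rep B.1.rep)
  have h : ∀ π : EpiHom F.1.rep B.1.rep, ENNReal.ofReal (layer M (N + 1) π) *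
      (Nat.card (Aut F.1.rep) : ENNReal)⁻¹ = ENNReal.ofReal (vSum L M F) := fun π => by
    rw [layer_of_loewyBounded hM hN, ENNReal.ofReal_mul (Nat.cast_nonneg _),
      ENNReal.ofReal_natCast, mul_right_comm,
      natCast_mul_inv_cancel _ (card_aut_ne_zero F.1.rep), one_mul]
  rw [tsum_fintype, Finset.sum_congr rfl fun π _ => h π, Finset.sum_const, Finset.card_univ,
    nsmul_eq_mul, Nat.card_eq_fintype_card, mul_comm]

theorem exists_hasMoments (hL : IsLevel L) {M : L → ℝ} (hM : WellBehaved L M)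
    (hv : ∀ F : L, 0 ≤ vSum L M F) : ∃ ν : Measure L, HasMoments ν M := by
  refine ⟨Measure.sum fun F : L => ENNReal.ofReal (vSum L M F) • Measure.dirac F, fun G => ?_⟩
  obtain ⟨h1, h2⟩ := ofReal_moment_eq_tsum hL hM hv G
  have h3 : moment (Measure.sum fun F : L => ENNReal.ofReal (vSum L M F) • Measure.dirac F) G
      = ENNReal.ofReal (M G) := by
    rw [h2, moment, lintegral_sum_measure]
    refine tsum_congr fun F => ?_
    rw [lintegral_smul_measure, lintegral_dirac, smul_eq_mul]
  rw [h3, EReal.coe_ennreal_ofReal, max_eq_left h1]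

end Existence

end DiamondMoments

theorem theoremT {C : Type u} [Category.{v} C] [DiamondMoments.DiamondCategory C]
    (L : Set (DiamondMoments.IsoClasses C)) (hL : DiamondMoments.IsLevel L)
    (M : L → ℝ) (hM : DiamondMoments.WellBehaved L M) :
    -- the series defining `v_{L, F}` converge (absolutely)
    (∀ F : L, Summable (DiamondMoments.vTerm L M F)) ∧
    -- existence
    ((∃ ν : Measure L, DiamondMoments.HasMoments ν M) ↔
      ∀ F : L, 0 ≤ DiamondMoments.vSum L M F) ∧
    -- uniqueness
    (∀ ν : Measure L, DiamondMoments.HasMoments ν M →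
      (∀ ν' : Measure L, DiamondMoments.HasMoments ν' M → ν' = ν) ∧
      ∀ F : L, ((ν {F} : ENNReal) : EReal) = (DiamondMoments.vSum L M F : EReal)) ∧
    -- robustness
    (∀ ν : ℕ → Measure L,
      (∀ G : L, Tendsto (fun t => (DiamondMoments.moment (ν t) G : EReal)) atTop
        (𝓝 (M G : EReal))) →
      ∀ F : L, Tendsto (fun t => ((ν t {F} : ENNReal) : EReal)) atTop
        (𝓝 (DiamondMoments.vSum L M F : EReal))) := by

  have huniq : ∀ ν : Measure L, DiamondMoments.HasMoments ν M →
      ∀ F : L, ((ν {F} : ENNReal) : EReal) = (DiamondMoments.vSum L M F : EReal) := by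
    intro ν hν F
    -- Robustness applied to a constant sequence.
    refine tendsto_nhds_unique tendsto_const_nhds
      (DiamondMoments.tendsto_of_tendsto_moment hL hM (ν := fun _ => ν) (fun G => ?_) F)
    rw [hν G]
    exact tendsto_const_nhds
  refine ⟨DiamondMoments.summable_vTerm hM, ⟨?_, DiamondMoments.exists_hasMoments hL hM⟩,
    fun ν hν => ⟨fun ν' hν' => ?_, huniq ν hν⟩,
    fun ν hν => DiamondMoments.tendsto_of_tendsto_moment hL hM hν⟩
  · rintro ⟨ν, hν⟩ F
    have h := EReal.coe_ennreal_nonneg (ν {F})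
    rw [huniq ν hν F] at h
    exact_mod_cast h
  -- On a countable discrete space a measure is determined by its values on points.
  · have := hL.countable.to_subtype
    refine Measure.ext_of_singleton fun F => ?_
    exact EReal.coe_ennreal_injective ((huniq ν' hν' F).trans (huniq ν hν F).symm)
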